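/- Setting. Let $d\in\{2,3\}$, $N\in\mathbb N$, $\Delta t>0$, $t^n=n\Delta t$, $\epsilon>0$, $\mu>0$. Let $\hat\Omega\subset\mathbb R^d$ be a polyhedral reference domain with a conforming triangulation into simplices $\hat K$, and for $0\le n\le N$ let $\mathcal A_{h,t^n}$ be an ALE map that is affine on every $\hat K$. For $\theta\in[0,1]$ and $n<N$ the linear interpolant in time $\mathcal A_{h,t^n+\theta\Delta t}=\theta\mathcal A_{h,t^{n+1}}+(1-\theta)\mathcal A_{h,t^n}$ is injective on $\overline{\hat\Omega}$. Put $\Omega_t=\mathcal A_{h,t}(\hat\Omega)$, $\mathcal T_{t}=\{\mathcal A_{h,t}(\hat K)\}$, $\mathcal A_{s,t}=\mathcal A_{h,t}\circ\mathcal A_{h,s}^{-1}$, and let $J_{\mathcal A_{s,t}}$ be the Jacobian determinant of $\mathcal A_{s,t}$. For $t\in[t^n,t^{n+1}]$ the mesh velocity on $\Omega_t$ is $\mathbf w_h=\frac1{\Delta t}(\mathcal A_{h,t^{n+1}}-\mathcal A_{h,t^n})\circ\mathcal A_{h,t}^{-1}$, and $\mathbf w_h^{n+1}$ denotes its value at $t=t^{n+1}$.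 A function on $\Omega_{t^m}$ is regarded as a function on $\Omega_{t^n}$ by composition with $\mathcal A_{t^n,t^m}$. Let $V_h^n$ be the space of continuous functions on $\overline{\Omega_{t^n}}$ that vanish on $\partial\Omega_{t^n}$ and are polynomials of degree at most $k$ on each $K\in\mathcal T_{t^n}$. At the levels $t^1,\dots,t^N$ let $\mathbf b$ be bounded and locally Lipschitz, $c\in L^\infty$, $f\in L^2$ on $\Omega_{t^n}$, and write $f^n=f(t^n,\cdot)$. For $n\ge1$ set $$a^n_{SUPG}(u,v)=\epsilon(\nabla u,\nabla v)_{\Omega_{t^n}}+(\mathbf b\cdot\nabla u,v)_{\Omega_{t^n}}+(cu,v)_{\Omega_{t^n}}+\sum_{K\in\mathcal T_{t^n}}\delta_K\big(-\epsilon\Delta u+(\mathbf b-\mathbf w_h^n)\cdot\nabla u+cu,(\mathbf b-\mathbf w_h^n)\cdot\nabla v\big)_K,$$ $$\ell^n(v)=(f^n,v)_{\Omega_{t^n}}+\sum_{K\in\mathcal T_{t^n}}\delta_K\big(f^n,(\mathbf b-\mathbf w_h^n)\cdot\nabla v\big)_K,$$ $$|||u|||_n^2=\epsilon\|\nabla u\|^2_{L^2(\Omega_{t^n})}+\sum_{K\in\mathcal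 T_{t^n}}\delta_K\|(\mathbf b-\mathbf w_h^n)\cdot\nabla u\|^2_{L^2(K)}+\mu\|u\|^2_{L^2(\Omega_{t^n})}.$$ Let $u_h^n\in V_h^n$ ($0\le n\le N$) satisfy the BDF-2 ALE-SUPG scheme: for $1\le n<N$ and all $v_h\in V_h^{n+1}$, $$\Big(\frac{\tfrac32u_h^{n+1}-2u_h^n+\tfrac12u_h^{n-1}}{\Delta t},v_h\Big)_{\Omega_{t^{n+1}}}+a^{n+1}_{SUPG}(u_h^{n+1},v_h)-\int_{\Omega_{t^{n+1}}}\mathbf w_h^{n+1}\cdot\nabla u_h^{n+1}\,v_h\,dx=\ell^{n+1}(v_h).$$ Put $$\alpha_1^n=\|\nabla\cdot\mathbf w_h^n\|_{L^\infty(\Omega_{t^n})}\ (1\le n\le N),\qquad \alpha_2^n=\sup_{t\in(t^n,t^{n+1})}\|J_{\mathcal A_{t^n,t^{n+1}}}\nabla\cdot\mathbf w_h\|_{L^\infty(\Omega_t)}\ (0\le n<N),$$ with $\alpha_1^0=0$ and $\alpha_2^N=0$. Lemma (stability of the BDF-2 ALE-SUPG scheme in non-conservative form). At the levels $t^1,\dots,t^N$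 assume that $c-\tfrac12\nabla\cdot\mathbf b\ge\mu$ a.e. in $\Omega_{t^n}$ and that, for all $K\in\mathcal T_{t^n}$, $$0\le\delta_K\le\frac{\mu}{2\|c\|_{K,\infty}^2},\qquad \delta_K\le\frac{h_K^2}{2\epsilon c_{inv}^2},\qquad\delta_K\le\frac{\Delta t}4$$ (a bound with zero denominator being void), where $h_K=\operatorname{diam}K$ and $c_{inv}$ is a constant of the inverse inequality $\|\Delta v_h\|_{L^2(K)}\le c_{inv}h_K^{-1}\|\nabla v_h\|_{L^2(K)}$, $v_h\in V_h^n$. Assume further that $\Delta t\,(2\alpha_1^n+\alpha_2^n)<1$ for $0\le n\le N$, and put $$G_{n+1}=\exp\Big(\Delta t\sum_{i=1}^{n+1}\frac{2\alpha_1^i+\alpha_2^i}{1-\Delta t(2\alpha_1^i+\alpha_2^i)}\Big).$$ (a) For arbitrary starting values $u_h^0\in V_h^0$, $u_h^1\in V_h^1$ and all $0\le n<N$, $$\|u_h^{n+1}\|^2_{L^2(\Omega_{t^{n+1}})}+\|2u_h^{n+1}-u_h^n\|^2_{L^2(\Omega_{t^{n+1}})}+\Delta t\sum_{i=2}^{n+1}|||u_h^i|||_i^2$$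 $$\le\Big(\tfrac12(1+\Delta t\,\alpha_2^0)\|u_h^0\|^2_{L^2(\Omega_{t^0})}+\tfrac32\|2u_h^1-u_h^0\|^2_{L^2(\Omega_{t^1})}+2\Delta t\sum_{i=2}^{n+1}\Big(\frac2\mu+\frac{\Delta t}2\Big)\|f^i\|^2_{L^2(\Omega_{t^i})}\Big)G_{n+1}.$$ (b) If $u_h^1$ is computed by one step of the implicit Euler scheme, i.e. for all $v_h\in V_h^1$ $$\Big(\frac{u_h^1-u_h^0}{\Delta t},v_h\Big)_{\Omega_{t^1}}+a^1_{SUPG}(u_h^1,v_h)-\int_{\Omega_{t^1}}\mathbf w_h^1\cdot\nabla u_h^1\,v_h\,dx=\ell^1(v_h),$$ then for all $0\le n<N$ $$\|u_h^{n+1}\|^2_{L^2(\Omega_{t^{n+1}})}+\|2u_h^{n+1}-u_h^n\|^2_{L^2(\Omega_{t^{n+1}})}+\frac{\Delta t}2|||u_h^1|||_1^2+\Delta t\sum_{i=2}^{n+1}|||u_h^i|||_i^2$$ $$\le\Big((1+\Delta t\,\alpha_2^0)\|u_h^0\|^2_{L^2(\Omega_{t^0})}+\|2u_h^1-u_h^0\|^2_{L^2(\Omega_{t^1})}+2\Delta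 t\sum_{i=1}^{n+1}\Big(\frac2\mu+\frac{\Delta t}2\Big)\|f^i\|^2_{L^2(\Omega_{t^i})}\Big)G_{n+1}.$$ -/

import Mathlib

open MeasureTheory Set
open scoped BigOperators ENNReal

noncomputable section

namespace ALESUPG

/-- The Euclidean space `ℝ^d`. -/
abbrev Space (d : ℕ) : Type := EuclideanSpace ℝ (Fin d)

/-- The divergence of a vector field. -/
def divergence {d : ℕ} (F : Space d → Space d) (x : Space d) : ℝ :=
  ∑ i : Fin d, fderiv ℝ F x (EuclideanSpace.single i 1) i

/-- A conforming (face-to-face) triangulation into `d`-simplices; a cell is given by its set of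
`d + 1` vertices. -/
structure Triangulation (d : ℕ) where
  cells : Finset (Finset (Space d))
  card_eq : ∀ K ∈ cells, K.card = d + 1
  affineIndependent : ∀ K ∈ cells, AffineIndependent ℝ (fun p : K => (p : Space d))
  inter_eq : ∀ K ∈ cells, ∀ L ∈ cells,
    convexHull ℝ (K : Set (Space d)) ∩ convexHull ℝ (L : Set (Space d)) =
      convexHull ℝ ((K : Set (Space d)) ∩ (L : Set (Space d)))

/-- The closed polyhedral region covered by the simplices. -/
def Triangulation.region {d : ℕ} (T : Triangulation d) : Set (Space d) :=
  ⋃ K ∈ T.cells, convexHull ℝ (K : Set (Space d))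

/-- The discrete ALE motion on the time levels `t^0, …, t^N`: a triangulated reference domain and
the maps `map n = 𝒜_{h,t^n}`, affine on every (closed) reference cell, so continuous on the
closed reference domain. The linear interpolants in time of two consecutive maps are bijections
of the closed reference domain onto their images. -/
structure ALEMotion (d N : ℕ) where
  ref : Triangulation d
  map : ℕ → Space d → Space d
  piecewiseAffine : ∀ n ≤ N, ∀ K ∈ ref.cells, ∃ g : Space d →ᵃ[ℝ] Space d,
    EqOn (map n) g (convexHull ℝ (K : Set (Space d)))
  injOn : ∀ n < N, ∀ θ ∈ Icc (0 : ℝ) 1,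
    InjOn (fun Y => θ • map (n + 1) Y + (1 - θ) • map n Y) ref.region

namespace ALEMotion

variable {d N : ℕ} (M : ALEMotion d N)

/-- The time-discrete ALE map at the time `t^n + θ Δt`, `θ ∈ [0,1]`. -/
def interp (n : ℕ) (θ : ℝ) (Y : Space d) : Space d :=
  θ • M.map (n + 1) Y + (1 - θ) • M.map n Y

/-- The inverse of `interp n θ`, from the moved domain to the reference domain. -/
def interpInv (n : ℕ) (θ : ℝ) : Space d → Space d :=
  Function.invFunOn (M.interp n θ) M.ref.region

/-- The inverse of `map n`, from the moved domain to the reference domain. -/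
def mapInv (n : ℕ) : Space d → Space d :=
  Function.invFunOn (M.map n) M.ref.region

/-- The domain `Ω_{t^n}`. -/
def domain (n : ℕ) : Set (Space d) := M.map n '' interior M.ref.region

/-- The domain `Ω_t` at the time `t = t^n + θ Δt`. -/
def interpDomain (n : ℕ) (θ : ℝ) : Set (Space d) := M.interp n θ '' interior M.ref.region

/-- The (closed) cell of the triangulation at time `t^n` with reference cell `K`. -/
def cell (n : ℕ) (K : Finset (Space d)) : Set (Space d) :=
  M.map n '' convexHull ℝ (K : Set (Space d))

/-- The ALE map `𝒜_{t^m,t^n} : Ω_{t^m} → Ω_{t^n}`. A function `v` on `Ω_{t^n}` is regarded as a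
function on `Ω_{t^m}` by means of `v ∘ transfer m n`. -/
def transfer (m n : ℕ) : Space d → Space d := M.map n ∘ M.mapInv m

/-- The Jacobian determinant of `𝒜_{t^n,t^{n+1}}`, a function on `Ω_{t^n}`. -/
def jacobian (n : ℕ) (x : Space d) : ℝ := (fderiv ℝ (M.transfer n (n + 1)) x).det

/-- The mesh velocity `w_h` on `Ω_t`, `t = t^n + θ Δt`: on the reference domain it is
`(map (n+1) - map n) / Δt`. -/
def stepVelocity (Δt : ℝ) (n : ℕ) (θ : ℝ) (x : Space d) : Space d :=
  Δt⁻¹ • (M.map (n + 1) (M.interpInv n θ x) - M.map n (M.interpInv n θ x))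

/-- The mesh velocity `w_h^n` on `Ω_{t^n}`, for `n ≥ 1`. No mesh velocity belongs to `n = 0`. -/
def velocity (Δt : ℝ) : ℕ → Space d → Space d
  | 0 => 0
  | n + 1 => M.stepVelocity Δt n 1

/-- `α₁^n = ‖∇·w_h(t^n)‖_{L^∞(Ω_{t^n})}`, with `α₁^0 = 0`. -/
def alpha₁ (Δt : ℝ) : ℕ → ℝ
  | 0 => 0
  | n + 1 => (eLpNorm (divergence (M.velocity Δt (n + 1))) ⊤
      (volume.restrict (M.domain (n + 1)))).toReal

/-- `α₂^n = sup_{t ∈ (t^n,t^{n+1})} ‖J_{𝒜_{t^n,t^{n+1}}} ∇·w_h‖_{L^∞(Ω_t)}` for `n < N`, with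
`J` transported to `Ω_t` by the ALE map; `α₂^N = 0`, there being no motion after the final time. -/
def alpha₂ (Δt : ℝ) (n : ℕ) : ℝ :=
  if n < N then
    (⨆ θ ∈ Ioo (0 : ℝ) 1,
      eLpNorm (fun x => M.jacobian n (M.map n (M.interpInv n θ x)) *
          divergence (M.stepVelocity Δt n θ) x) ⊤
        (volume.restrict (M.interpDomain n θ))).toReal
  else 0

/-- The conforming finite element space `V_h` at time `t^n`: continuous functions on the closed
domain that vanish on its boundary and are polynomials of degree at most `k` on every cell. -/
def feSpace (k n : ℕ) : Set (Space d → ℝ) :=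
  {v | ContinuousOn v (closure (M.domain n)) ∧ (∀ x ∈ frontier (M.domain n), v x = 0) ∧
    ∀ K ∈ M.ref.cells, ∃ p : MvPolynomial (Fin d) ℝ, p.totalDegree ≤ k ∧
      ∀ x ∈ M.cell n K, v x = MvPolynomial.eval (fun i => x i) p}

/-- The square of the norm of `L²(Ω_{t^n})`. -/
def normSq (n : ℕ) (v : Space d → ℝ) : ℝ := ∫ x in M.domain n, v x ^ 2

/-- `cinv` is a constant of the inverse inequality `‖Δv‖_{0,K} ≤ cinv h_K⁻¹ |v|_{1,K}` on the
finite element spaces of the time levels `t^1, …, t^N`. -/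
def IsInverseConstant (k : ℕ) (cinv : ℝ) : Prop :=
  ∀ n, 1 ≤ n → n ≤ N → ∀ v ∈ M.feSpace k n, ∀ K ∈ M.ref.cells,
    Metric.diam (M.cell n K) ^ 2 * ∫ x in M.cell n K, Laplacian.laplacian v x ^ 2 ≤
      cinv ^ 2 * ∫ x in M.cell n K, ‖gradient v x‖ ^ 2

end ALEMotion

/-- The data of the fully discrete scheme: the motion of the mesh, the polynomial degree `k`, the
time step, the diffusivity, the convective velocity `b(t,x)`, the reaction `c(t,x)`, the source
`f(t,x)`, and the stabilization parameters `δ_K` at the time levels (`K` is the reference cell). -/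
structure SchemeData (d N : ℕ) where
  motion : ALEMotion d N
  k : ℕ
  Δt : ℝ
  ε : ℝ
  b : ℝ → Space d → Space d
  c : ℝ → Space d → ℝ
  f : ℝ → Space d → ℝ
  δ : ℕ → Finset (Space d) → ℝ

namespace SchemeData

variable {d N : ℕ} (P : SchemeData d N)

/-- The time level `t^n = n Δt`. -/
def time (n : ℕ) : ℝ := n * P.Δt

/-- The streamline derivative `(b - w_h^n) · ∇v` at time `t^n`. -/
def streamline (n : ℕ) (v : Space d → ℝ) (x : Space d) : ℝ :=
  inner ℝ (P.b (P.time n) x - P.motion.velocity P.Δt n x) (gradient v x)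

/-- The bilinear form `a^n_SUPG`. -/
def aSUPG (n : ℕ) (u v : Space d → ℝ) : ℝ :=
  P.ε * (∫ x in P.motion.domain n, inner ℝ (gradient u x) (gradient v x)) +
  (∫ x in P.motion.domain n, inner ℝ (P.b (P.time n) x) (gradient u x) * v x) +
  (∫ x in P.motion.domain n, P.c (P.time n) x * u x * v x) +
  ∑ K ∈ P.motion.ref.cells, P.δ n K * ∫ x in P.motion.cell n K,
    (-P.ε * Laplacian.laplacian u x + P.streamline n u x + P.c (P.time n) x * u x) *
      P.streamline n v x

/-- The spatial part of the scheme, including the mesh velocity term. -/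
def spatialForm (n : ℕ) (u v : Space d → ℝ) : ℝ :=
  P.aSUPG n u v -
    ∫ x in P.motion.domain n, inner ℝ (P.motion.velocity P.Δt n x) (gradient u x) * v x

/-- The right-hand side of the scheme. -/
def load (n : ℕ) (v : Space d → ℝ) : ℝ :=
  (∫ x in P.motion.domain n, P.f (P.time n) x * v x) +
  ∑ K ∈ P.motion.ref.cells, P.δ n K * ∫ x in P.motion.cell n K,
    P.f (P.time n) x * P.streamline n v x

/-- The square of the mesh dependent norm `|||u|||` at time `t^n`. -/
def tripleNormSq (μ : ℝ) (n : ℕ) (u : Space d → ℝ) : ℝ :=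
  P.ε * (∫ x in P.motion.domain n, ‖gradient u x‖ ^ 2) +
  (∑ K ∈ P.motion.ref.cells, P.δ n K * ∫ x in P.motion.cell n K, P.streamline n u x ^ 2) +
  μ * P.motion.normSq n u

/-- One implicit Euler step, from `t^n` to `t^{n+1}`. -/
def IsEulerStep (u : ℕ → Space d → ℝ) (n : ℕ) : Prop :=
  ∀ v ∈ P.motion.feSpace P.k (n + 1),
    (∫ x in P.motion.domain (n + 1),
      (u (n + 1) x - u n (P.motion.transfer (n + 1) n x)) / P.Δt * v x) +
      P.spatialForm (n + 1) (u (n + 1)) v = P.load (n + 1) v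

/-- One step of the second order backward difference formula (BDF-2), from `t^{n-1}` and `t^n`
to `t^{n+1}`, for `n ≥ 1`. -/
def IsBDF2Step (u : ℕ → Space d → ℝ) (n : ℕ) : Prop :=
  ∀ v ∈ P.motion.feSpace P.k (n + 1),
    (∫ x in P.motion.domain (n + 1),
      (3 / 2 * u (n + 1) x - 2 * u n (P.motion.transfer (n + 1) n x) +
        1 / 2 * u (n - 1) (P.motion.transfer (n + 1) (n - 1) x)) / P.Δt * v x) +
      P.spatialForm (n + 1) (u (n + 1)) v = P.load (n + 1) v

/-- `2 α₁^n + α₂^n`. -/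
def growth (n : ℕ) : ℝ := 2 * P.motion.alpha₁ P.Δt n + P.motion.alpha₂ P.Δt n

/-- The factor `exp(Δt ∑_{i=1}^{n} (2α₁^i + α₂^i) / (1 - Δt (2α₁^i + α₂^i)))`. -/
def growthFactor (n : ℕ) : ℝ :=
  Real.exp (P.Δt * ∑ i ∈ Finset.Icc 1 n, P.growth i / (1 - P.Δt * P.growth i))

/-- `‖2u^{n+1} - u^n‖²` in `L²(Ω_{t^{n+1}})`. -/
def extrapolationSq (u : ℕ → Space d → ℝ) (n : ℕ) : ℝ :=
  P.motion.normSq (n + 1) fun x =>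
    2 * u (n + 1) x - u n (P.motion.transfer (n + 1) n x)

end SchemeData

end ALESUPG

end

/-!
Tested with `u^{n+1}`, the spatial form is coercive up to the divergence of the mesh velocity.
Indeed `-ε Δu`, `c u` and the streamline derivative are separated by Young's inequality, the bounds
on `δ_K` absorb the first two, and the convective terms are integrated by parts. Since `b` is only
locally Lipschitz, this needs compact support inside the domain: a finite element function extended
by zero is Lipschitz, soft thresholding pushes its support into the interior, and the threshold then
tends to zero.

In time, BDF-2 is G-stable: `2 (3a - 4b + c) a = a² + (2a - b)² - b² - (2b - c)² + (a - 2b + c)²`.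
The old energy lives on the old domain. On a cell the transfer changes an integral by the constant
factor `|J|`, and `log |J|` is `Δt` times a value of `∇·w_h`, since the logarithmic derivative of
`det ((1 - θ) A + θ B)` is the trace that gives the divergence. With `1 - 1/|J| ≤ log |J|` this
yields `|J| ≤ 1 + Δt α₂`. The energies therefore satisfy
`(1 - 2 Δt α₁^{n+1}) E_{n+1} + dissipation ≤ (1 + Δt α₂^n) E_n + load`, and the discrete Gronwall
inequality sums them.
-/

noncomputable section

namespace ALESUPG

open Filter Topology
open scoped NNReal

section Measure

variable {α E ι : Type*} [MeasurableSpace α] [NormedAddCommGroup E] {f : α → E} {s : Finset ι}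
  {μ : ι → Measure α}

theorem eLpNorm_top_finsetSum_measure (f : α → E) (s : Finset ι) (μ : ι → Measure α) :
    eLpNorm f ⊤ (∑ i ∈ s, μ i) = ⨆ i ∈ s, eLpNorm f ⊤ (μ i) := by
  refine le_antisymm ?_ (iSup₂_le fun i hi => eLpNorm_mono_measure f
    (Finset.single_le_sum (f := μ) (fun _ _ => Measure.zero_le _) hi))
  rw [eLpNorm_exponent_top]
  refine essSup_le_of_ae_le _ (ae_finsetSum_measure_iff.2 fun i hi => ?_)
  filter_upwards [ae_le_eLpNormEssSup (f := f) (μ := μ i)] with x hx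
  exact hx.trans (le_iSup₂ (f := fun i _ => eLpNorm f ⊤ (μ i)) i hi)

theorem memLp_finsetSum_measure {p : ℝ≥0∞} (h : ∀ i ∈ s, MemLp f p (μ i)) :
    MemLp f p (∑ i ∈ s, μ i) := by
  constructor
  · rw [← Finset.sum_coe_sort, ← Measure.sum_fintype]
    exact aestronglyMeasurable_sum_measure_iff.2 fun i => (h i i.2).1
  rcases eq_or_ne p 0 with rfl | hp0
  · simp
  rcases eq_or_ne p ⊤ with rfl | hp
  · rw [eLpNorm_top_finsetSum_measure, ← Finset.sup_eq_iSup, Finset.sup_lt_iff ENNReal.zero_lt_top]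
    exact fun i hi => (h i hi).2
  · simp only [eLpNorm_lt_top_iff_lintegral_rpow_enorm_lt_top hp0 hp, lintegral_finsetSum_measure,
      ENNReal.sum_lt_top]
    exact fun i hi => (eLpNorm_lt_top_iff_lintegral_rpow_enorm_lt_top hp0 hp).1 (h i hi).2

theorem memLp_of_isCompact_of_continuousOn [TopologicalSpace α] [OpensMeasurableSpace α]
    [T2Space α] [TopologicalSpace.PseudoMetrizableSpace α] {ν : Measure α}
    [IsFiniteMeasureOnCompacts ν] {K : Set α} (hK : IsCompact K) (hf : ContinuousOn f K)
    (p : ℝ≥0∞) : MemLp f p (ν.restrict K) := by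
  have : IsFiniteMeasure (ν.restrict K) := isFiniteMeasure_restrict.2 hK.measure_lt_top.ne
  obtain ⟨C, hC⟩ := hK.exists_bound_of_continuousOn hf
  exact MemLp.of_bound (hf.aestronglyMeasurable_of_isCompact hK hK.measurableSet) C
    (ae_restrict_of_forall_mem hK.measurableSet hC)

end Measure

section Affine

variable {E F : Type*} [NormedAddCommGroup E] [NormedSpace ℝ E] [AddCommGroup F] [Module ℝ F]

theorem injective_of_injOn_of_interior_nonempty {g : E →ᵃ[ℝ] F} {s : Set E}
    (hs : (interior s).Nonempty) (hg : InjOn g s) : Function.Injective g := by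
  obtain ⟨x, hx⟩ := hs
  rw [← g.linear_injective_iff, injective_iff_map_eq_zero]
  intro v hv
  have hmem : ∀ᶠ t : ℝ in 𝓝[≠] 0, x + t • v ∈ s := by
    have hcont : Continuous fun t : ℝ => x + t • v := by fun_prop
    exact nhdsWithin_le_nhds (hcont.tendsto' 0 x (by simp) (mem_interior_iff_mem_nhds.1 hx))
  obtain ⟨t, hts, ht : t ≠ 0⟩ := (hmem.and self_mem_nhdsWithin).exists
  have hgt : g (x + t • v) = g x := by
    rw [add_comm, ← vadd_eq_add, g.map_vadd, map_smul, hv, smul_zero, zero_vadd]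
  simpa [ht] using hg hts (interior_subset hx) hgt

end Affine

section Simplex

variable {d : ℕ} {T : Triangulation d} {K L : Finset (Space d)}

theorem isCompact_simplex (K : Finset (Space d)) :
    IsCompact (convexHull ℝ (K : Set (Space d))) :=
  K.finite_toSet.isCompact_convexHull ℝ

namespace Triangulation

theorem centroid_mem_interior (hK : K ∈ T.cells) :
    K.centroid ℝ id ∈ interior (convexHull ℝ (K : Set (Space d))) := by
  have hspan := (T.affineIndependent K hK).affineSpan_eq_top_iff_card_eq_finrank_add_one.2
    (by simpa using T.card_eq K hK)
  have h : Finset.univ.centroid ℝ ((↑) : K → Space d) ∈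
      interior (convexHull ℝ (range ((↑) : K → Space d))) :=
    (AffineBasis.mk _ (T.affineIndependent K hK) hspan).centroid_mem_interior_convexHull
  rwa [Finset.centroid_univ, Subtype.range_coe_subtype, Finset.setOfPred_mem] at h

theorem interior_nonempty (hK : K ∈ T.cells) :
    (interior (convexHull ℝ (K : Set (Space d)))).Nonempty :=
  ⟨_, centroid_mem_interior hK⟩

theorem simplex_subset_region (hK : K ∈ T.cells) :
    convexHull ℝ (K : Set (Space d)) ⊆ T.region :=
  subset_biUnion_of_mem (u := fun K : Finset (Space d) => convexHull ℝ (K : Set (Space d))) hK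

theorem isCompact_region (T : Triangulation d) : IsCompact T.region :=
  T.cells.isCompact_biUnion fun K _ => isCompact_simplex K

theorem volume_inter_eq_zero (hK : K ∈ T.cells) (hL : L ∈ T.cells) (hKL : K ≠ L) :
    volume (convexHull ℝ (K : Set (Space d)) ∩ convexHull ℝ (L : Set (Space d))) = 0 := by
  classical
  rw [T.inter_eq K hK L hL, ← Finset.coe_inter]
  have hss : K ∩ L ⊂ K := by
    refine Finset.ssubset_iff_subset_ne.2 ⟨Finset.inter_subset_left, fun h => hKL ?_⟩
    exact Finset.eq_of_subset_of_card_le (Finset.inter_eq_left.1 h)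
      (by rw [T.card_eq K hK, T.card_eq L hL])
  have hcard : (K ∩ L).card < d + 1 := T.card_eq K hK ▸ Finset.card_lt_card hss
  refine measure_mono_null (convexHull_subset_affineSpan _)
    (Measure.addHaar_affineSubspace _ _ fun htop => ?_)
  have hind : AffineIndependent ℝ (fun p : (K ∩ L : Finset (Space d)) => (p : Space d)) :=
    (T.affineIndependent K hK).mono (s := ((K ∩ L : Finset (Space d)) : Set (Space d)))
      (t := (K : Set (Space d))) (by exact_mod_cast hss.1)
  have := hind.affineSpan_eq_top_iff_card_eq_finrank_add_one.1
    (by rwa [Subtype.range_coe_subtype, Finset.setOfPred_mem])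
  simp only [Fintype.card_coe, finrank_euclideanSpace, Fintype.card_fin] at this
  omega

end Triangulation

end Simplex

/-! ### Deformed triangulations -/

/-- `φ` is affine on every cell of the triangulation and injective on the region it covers: the
spatial structure of an ALE map at a fixed time. -/
structure Triangulation.IsDeformation {d : ℕ} (T : Triangulation d) (φ : Space d → Space d) :
    Prop where
  affine : ∀ K ∈ T.cells, ∃ g : Space d →ᵃ[ℝ] Space d,
    EqOn φ g (convexHull ℝ (K : Set (Space d)))
  injOn : InjOn φ T.region

/-- The closed cell of the deformed triangulation with reference cell `K`. -/
def imageCell {d : ℕ} (φ : Space d → Space d) (K : Finset (Space d)) : Set (Space d) :=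
  φ '' convexHull ℝ (K : Set (Space d))

namespace Triangulation

variable {d : ℕ} (T : Triangulation d)

/-- The deformed domain. The proofs below integrate over its interior, which has full measure, and
so do not depend on invariance of domain. -/
def imageDomain (φ : Space d → Space d) : Set (Space d) := φ '' interior T.region

/-- The inverse of a deformation, from the deformed to the reference configuration. -/
def inverse (φ : Space d → Space d) : Space d → Space d := Function.invFunOn φ T.region

theorem region_eq_iUnion : T.region = ⋃ K : T.cells, convexHull ℝ (K.1 : Set (Space d)) :=
  (iUnion_subtype (fun K => K ∈ T.cells) fun K => convexHull ℝ (K.1 : Set (Space d))).symm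

theorem image_region (φ : Space d → Space d) :
    φ '' T.region = ⋃ K : T.cells, imageCell φ K.1 := by
  simp only [region_eq_iUnion, image_iUnion, imageCell]

theorem imageDomain_subset_image_region (φ : Space d → Space d) :
    T.imageDomain φ ⊆ φ '' T.region :=
  image_mono interior_subset

end Triangulation

namespace Triangulation.IsDeformation

variable {d : ℕ} {T : Triangulation d} {φ ψ : Space d → Space d} {K L : Finset (Space d)}

theorem exists_affineEquiv (h : T.IsDeformation φ) (hK : K ∈ T.cells) :
    ∃ e : Space d ≃ᴬ[ℝ] Space d, EqOn φ e (convexHull ℝ (K : Set (Space d))) := by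
  obtain ⟨g, hg⟩ := h.affine K hK
  have hinj : Function.Injective g := injective_of_injOn_of_interior_nonempty
    (interior_nonempty hK) ((h.injOn.mono (simplex_subset_region hK)).congr hg)
  have hbij : Function.Bijective g := g.linear_bijective_iff.1
    ⟨g.linear_injective_iff.2 hinj,
      LinearMap.injective_iff_surjective.1 (g.linear_injective_iff.2 hinj)⟩
  exact ⟨AffineEquiv.toContinuousAffineEquiv (AffineEquiv.ofBijective hbij), hg⟩

theorem interior_imageCell (h : T.IsDeformation φ) (hK : K ∈ T.cells) :
    interior (imageCell φ K) = φ '' interior (convexHull ℝ (K : Set (Space d))) := by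
  obtain ⟨e, he⟩ := h.exists_affineEquiv hK
  rw [imageCell, he.image_eq, (he.mono interior_subset).image_eq]
  exact (e.toHomeomorph.image_interior _).symm

theorem continuousOn_region (h : T.IsDeformation φ) : ContinuousOn φ T.region := by
  have hcell (K : T.cells) : ContinuousOn φ (convexHull ℝ (K : Set (Space d))) := by
    obtain ⟨e, he⟩ := h.exists_affineEquiv K.2
    exact e.continuous.continuousOn.congr he
  rw [T.region_eq_iUnion]
  exact (locallyFinite_of_finite _).continuousOn_iUnion
    (fun K => (isCompact_simplex K.1).isClosed) hcell

theorem isCompact_imageCell (h : T.IsDeformation φ) (hK : K ∈ T.cells) :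
    IsCompact (imageCell φ K) :=
  (isCompact_simplex K).image_of_continuousOn
    (h.continuousOn_region.mono (simplex_subset_region hK))

theorem convex_imageCell (h : T.IsDeformation φ) (hK : K ∈ T.cells) :
    Convex ℝ (imageCell φ K) := by
  obtain ⟨e, he⟩ := h.exists_affineEquiv hK
  rw [imageCell, he.image_eq]
  exact (convex_convexHull ℝ _).affine_image e.toAffineEquiv.toAffineMap

theorem interior_imageCell_nonempty (h : T.IsDeformation φ) (hK : K ∈ T.cells) :
    (interior (imageCell φ K)).Nonempty := by
  rw [h.interior_imageCell hK]
  exact (interior_nonempty hK).image _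

theorem measurableSet_imageCell (h : T.IsDeformation φ) (hK : K ∈ T.cells) :
    MeasurableSet (imageCell φ K) := (h.isCompact_imageCell hK).measurableSet

theorem interior_ae_eq_imageCell (h : T.IsDeformation φ) (hK : K ∈ T.cells) :
    interior (imageCell φ K) =ᵐ[volume] imageCell φ K :=
  interior_ae_eq_of_null_frontier ((h.convex_imageCell hK).addHaar_frontier volume)

theorem ae_mem_interior_imageCell (h : T.IsDeformation φ) (hK : K ∈ T.cells) :
    ∀ᵐ x ∂(volume.restrict (imageCell φ K)), x ∈ interior (imageCell φ K) := by
  rw [← Measure.restrict_congr_set (h.interior_ae_eq_imageCell hK)]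
  exact ae_restrict_mem isOpen_interior.measurableSet

theorem interior_imageCell_subset_imageDomain (h : T.IsDeformation φ) (hK : K ∈ T.cells) :
    interior (imageCell φ K) ⊆ T.imageDomain φ := by
  rw [h.interior_imageCell hK]
  exact image_mono (interior_mono (simplex_subset_region hK))

theorem interior_imageDomain_ae_eq_image_region (h : T.IsDeformation φ) :
    interior (T.imageDomain φ) =ᵐ[volume] φ '' T.region := by
  refine (interior_subset.trans (T.imageDomain_subset_image_region φ)).eventuallyLE.antisymm ?_
  have hcells : (⋃ K : T.cells, interior (imageCell φ K)) =ᵐ[volume] φ '' T.region := by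
    rw [T.image_region]
    exact Filter.EventuallyEq.countable_iUnion fun K => h.interior_ae_eq_imageCell K.2
  exact hcells.symm.le.trans (LE.le.eventuallyLE (iUnion_subset fun K =>
    interior_maximal (h.interior_imageCell_subset_imageDomain K.2) isOpen_interior))

theorem imageDomain_ae_eq_image_region (h : T.IsDeformation φ) :
    T.imageDomain φ =ᵐ[volume] φ '' T.region :=
  (T.imageDomain_subset_image_region φ).eventuallyLE.antisymm
    (h.interior_imageDomain_ae_eq_image_region.symm.le.trans interior_subset.eventuallyLE)

theorem interior_imageDomain_ae_eq (h : T.IsDeformation φ) :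
    interior (T.imageDomain φ) =ᵐ[volume] T.imageDomain φ :=
  h.interior_imageDomain_ae_eq_image_region.trans h.imageDomain_ae_eq_image_region.symm

theorem closure_imageDomain (h : T.IsDeformation φ) :
    closure (T.imageDomain φ) = φ '' T.region := by
  refine (closure_minimal (T.imageDomain_subset_image_region φ)
    (T.isCompact_region.image_of_continuousOn h.continuousOn_region).isClosed).antisymm ?_
  rw [T.image_region]
  refine iUnion_subset fun K => ?_
  have hcl : closure (interior (imageCell φ K.1)) = imageCell φ K.1 := by
    rw [(h.convex_imageCell K.2).closure_interior_eq_closure_of_nonempty_interior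
      (h.interior_imageCell_nonempty K.2), (h.isCompact_imageCell K.2).isClosed.closure_eq]
  exact hcl.symm.subset.trans (closure_mono (h.interior_imageCell_subset_imageDomain K.2))

theorem isCompact_closure_imageDomain (h : T.IsDeformation φ) :
    IsCompact (closure (T.imageDomain φ)) := by
  rw [h.closure_imageDomain]
  exact T.isCompact_region.image_of_continuousOn h.continuousOn_region

theorem imageCell_subset_closure (h : T.IsDeformation φ) (hK : K ∈ T.cells) :
    imageCell φ K ⊆ closure (T.imageDomain φ) := by
  rw [h.closure_imageDomain]
  exact image_mono (simplex_subset_region hK)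

theorem continuousOn_closure {E : Type*} [TopologicalSpace E] (h : T.IsDeformation φ)
    {F : Space d → E} (hF : ∀ K ∈ T.cells, ContinuousOn F (imageCell φ K)) :
    ContinuousOn F (closure (T.imageDomain φ)) := by
  rw [h.closure_imageDomain, T.image_region]
  exact (locallyFinite_of_finite _).continuousOn_iUnion
    (fun K : T.cells => (h.isCompact_imageCell K.2).isClosed) fun K => hF K K.2

theorem aedisjoint_imageCell (h : T.IsDeformation φ) (hK : K ∈ T.cells) (hL : L ∈ T.cells)
    (hKL : K ≠ L) : AEDisjoint volume (imageCell φ K) (imageCell φ L) := by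
  obtain ⟨e, he⟩ := h.exists_affineEquiv hK
  rw [AEDisjoint, imageCell, imageCell,
    ← h.injOn.image_inter (simplex_subset_region hK) (simplex_subset_region hL),
    (he.mono inter_subset_left).image_eq]
  exact addHaar_image_eq_zero_of_differentiableOn_of_addHaar_eq_zero volume
    e.toContinuousAffineMap.differentiable.differentiableOn
    (volume_inter_eq_zero hK hL hKL)

theorem restrict_imageDomain (h : T.IsDeformation φ) :
    volume.restrict (T.imageDomain φ) =
      ∑ K ∈ T.cells, volume.restrict (imageCell φ K) := by
  rw [Measure.restrict_congr_set h.imageDomain_ae_eq_image_region, T.image_region,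
    Measure.restrict_iUnion_ae
      (fun K L hKL => h.aedisjoint_imageCell K.2 L.2 (Subtype.coe_ne_coe.2 hKL))
      (fun K => (h.measurableSet_imageCell K.2).nullMeasurableSet), Measure.sum_fintype]
  exact Finset.sum_coe_sort T.cells fun K => volume.restrict (imageCell φ K)

theorem restrict_imageCell_le (h : T.IsDeformation φ) (hK : K ∈ T.cells) :
    volume.restrict (imageCell φ K) ≤ volume.restrict (T.imageDomain φ) := by
  rw [h.restrict_imageDomain]
  exact Finset.single_le_sum (f := fun K => volume.restrict (imageCell φ K))
    (fun _ _ => Measure.zero_le _) hK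

theorem integral_imageDomain (h : T.IsDeformation φ) {f : Space d → ℝ}
    (hf : Integrable f (volume.restrict (T.imageDomain φ))) :
    ∫ x in T.imageDomain φ, f x = ∑ K ∈ T.cells, ∫ x in imageCell φ K, f x := by
  rw [h.restrict_imageDomain, integral_finsetSum_measure]
  exact fun K hK => hf.mono_measure (h.restrict_imageCell_le hK)

theorem ae_imageDomain_iff (h : T.IsDeformation φ) {p : Space d → Prop} :
    (∀ᵐ x ∂(volume.restrict (T.imageDomain φ)), p x) ↔
      ∀ K ∈ T.cells, ∀ᵐ x ∂(volume.restrict (imageCell φ K)), p x := by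
  rw [h.restrict_imageDomain, ae_finsetSum_measure_iff]

theorem memLp_imageDomain {E : Type*} [NormedAddCommGroup E] (h : T.IsDeformation φ)
    {v : Space d → E} {p : ℝ≥0∞}
    (hv : ∀ K ∈ T.cells, MemLp v p (volume.restrict (imageCell φ K))) :
    MemLp v p (volume.restrict (T.imageDomain φ)) := by
  rw [h.restrict_imageDomain]
  exact memLp_finsetSum_measure hv

theorem eLpNorm_top_imageDomain {E : Type*} [NormedAddCommGroup E] (h : T.IsDeformation φ)
    {v : Space d → E} {c : Finset (Space d) → E}
    (hv : ∀ K ∈ T.cells, ∀ x ∈ interior (imageCell φ K), v x = c K) :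
    eLpNorm v ⊤ (volume.restrict (T.imageDomain φ)) = ⨆ K ∈ T.cells, ‖c K‖ₑ := by
  rw [h.restrict_imageDomain, eLpNorm_top_finsetSum_measure]
  refine iSup_congr fun K => iSup_congr fun hK => ?_
  have hne : volume.restrict (imageCell φ K) ≠ 0 :=
    Measure.restrict_eq_zero.not.2 (Measure.measure_pos_of_nonempty_interior _
      (h.interior_imageCell_nonempty hK)).ne'
  rw [eLpNorm_congr_ae ((h.ae_mem_interior_imageCell hK).mono (hv K hK)),
    eLpNorm_exponent_top, eLpNormEssSup_const _ hne]

theorem isFiniteMeasure_imageDomain (h : T.IsDeformation φ) :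
    IsFiniteMeasure (volume.restrict (T.imageDomain φ)) :=
  isFiniteMeasure_restrict.2
    ((measure_mono subset_closure).trans_lt h.isCompact_closure_imageDomain.measure_lt_top).ne

theorem memLp_of_continuousOn {E : Type*} [NormedAddCommGroup E] (h : T.IsDeformation φ)
    {v : Space d → E} (hv : ContinuousOn v (closure (T.imageDomain φ))) (p : ℝ≥0∞) :
    MemLp v p (volume.restrict (T.imageDomain φ)) :=
  (memLp_of_isCompact_of_continuousOn h.isCompact_closure_imageDomain hv p).mono_measure
    (Measure.restrict_mono_set _ subset_closure)

theorem inverse_apply (h : T.IsDeformation φ) {Y : Space d} (hY : Y ∈ T.region) :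
    T.inverse φ (φ Y) = Y :=
  h.injOn.leftInvOn_invFunOn hY

theorem inverse_eqOn (h : T.IsDeformation φ) (hK : K ∈ T.cells) {e : Space d ≃ᴬ[ℝ] Space d}
    (he : EqOn φ e (convexHull ℝ (K : Set (Space d)))) :
    EqOn (T.inverse φ) e.symm (imageCell φ K) := by
  rintro _ ⟨Y, hY, rfl⟩
  rw [h.inverse_apply (simplex_subset_region hK hY), he hY, e.symm_apply_apply]

theorem inverse_mem (h : T.IsDeformation φ) (hK : K ∈ T.cells) {x : Space d}
    (hx : x ∈ imageCell φ K) : T.inverse φ x ∈ convexHull ℝ (K : Set (Space d)) := by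
  obtain ⟨Y, hY, rfl⟩ := hx
  rwa [h.inverse_apply (simplex_subset_region hK hY)]

theorem continuousOn_inverse (h : T.IsDeformation φ) :
    ContinuousOn (T.inverse φ) (closure (T.imageDomain φ)) :=
  h.continuousOn_closure fun K hK => by
    obtain ⟨e, he⟩ := h.exists_affineEquiv hK
    exact e.symm.continuous.continuousOn.congr (h.inverse_eqOn hK he)

theorem continuousOn_transfer {E : Type*} [TopologicalSpace E] (h : T.IsDeformation φ)
    (h' : T.IsDeformation ψ) {v : Space d → E} (hv : ContinuousOn v (closure (T.imageDomain φ))) :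
    ContinuousOn (fun x => v (φ (T.inverse ψ x))) (closure (T.imageDomain ψ)) := by
  have hmaps : MapsTo (T.inverse ψ) (closure (T.imageDomain ψ)) T.region := by
    rw [h'.closure_imageDomain]
    rintro _ ⟨Y, hY, rfl⟩
    rwa [h'.inverse_apply hY]
  refine hv.comp (h.continuousOn_region.comp h'.continuousOn_inverse hmaps) fun x hx => ?_
  rw [h.closure_imageDomain]
  exact mem_image_of_mem φ (hmaps hx)

end Triangulation.IsDeformation

/-! ### Jacobian matrices -/

section Det

variable {m : Type*} [Fintype m] [DecidableEq m]

theorem hasDerivAt_det_segment (A B : Matrix m m ℝ) {θ : ℝ}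
    (h : (θ • B + (1 - θ) • A).det ≠ 0) :
    HasDerivAt (fun t : ℝ => (t • B + (1 - t) • A).det)
      ((θ • B + (1 - θ) • A).det * ((B - A) * (θ • B + (1 - θ) • A)⁻¹).trace) θ := by
  set L := θ • B + (1 - θ) • A with hL
  set N := L⁻¹ * (B - A) with hN
  have hLN : L * N = B - A := Matrix.mul_nonsing_inv_cancel_left L _ (isUnit_iff_ne_zero.2 h)
  obtain ⟨q, hq⟩ : ∃ q : Polynomial ℝ, ∀ r : ℝ,
      (1 + r • N).det = 1 + N.trace * r + q.eval r * r ^ 2 :=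
    ⟨_, fun r => Matrix.det_one_add_smul r N⟩
  have hfun (t : ℝ) : (t • B + (1 - t) • A).det =
      L.det * (1 + N.trace * (t - θ) + q.eval (t - θ) * (t - θ) ^ 2) := by
    rw [← hq, ← Matrix.det_mul, mul_add, mul_one, Matrix.mul_smul, hLN, hL]
    congr 1
    module
  have hsub : HasDerivAt (fun t : ℝ => t - θ) 1 θ := (hasDerivAt_id θ).sub_const θ
  have hq' : HasDerivAt (fun t : ℝ => q.eval (t - θ)) (q.derivative.eval (θ - θ)) θ :=
    (q.hasDerivAt (θ - θ)).comp_sub_const θ θ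
  rw [Matrix.trace_mul_comm, ← hN, funext hfun]
  refine (((hsub.const_mul N.trace).const_add 1).add
    (hq'.mul (hsub.pow 2))).const_mul L.det |>.congr_deriv ?_
  simp

theorem exists_log_det_eq_trace (A B : Matrix m m ℝ)
    (h : ∀ θ ∈ Icc (0 : ℝ) 1, (θ • B + (1 - θ) • A).det ≠ 0) :
    ∃ θ ∈ Ioo (0 : ℝ) 1, Real.log (B.det / A.det) =
      ((B - A) * (θ • B + (1 - θ) • A)⁻¹).trace := by
  have hderiv (θ : ℝ) (hθ : θ ∈ Icc (0 : ℝ) 1) :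
      HasDerivAt (fun t : ℝ => Real.log (t • B + (1 - t) • A).det)
        (((B - A) * (θ • B + (1 - θ) • A)⁻¹).trace) θ := by
    refine ((hasDerivAt_det_segment A B (h θ hθ)).log (h θ hθ)).congr_deriv ?_
    exact mul_div_cancel_left₀ _ (h θ hθ)
  obtain ⟨θ, hθ, heq⟩ := exists_hasDerivAt_eq_slope _ _ zero_lt_one
    (fun θ hθ => (hderiv θ hθ).continuousAt.continuousWithinAt)
    (fun θ hθ => hderiv θ (Ioo_subset_Icc_self hθ))
  have hA : A.det ≠ 0 := by simpa using h 0 ⟨le_rfl, zero_le_one⟩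
  have hB : B.det ≠ 0 := by simpa using h 1 ⟨zero_le_one, le_rfl⟩
  exact ⟨θ, hθ, by simpa [Real.log_div hB hA] using heq.symm⟩

theorem exists_bound_trace_segment (A B : Matrix m m ℝ)
    (h : ∀ θ ∈ Icc (0 : ℝ) 1, (θ • B + (1 - θ) • A).det ≠ 0) :
    ∃ C, ∀ θ ∈ Icc (0 : ℝ) 1, |((B - A) * (θ • B + (1 - θ) • A)⁻¹).trace| ≤ C := by
  have hsegment : Continuous fun θ : ℝ => θ • B + (1 - θ) • A := by fun_prop
  refine isCompact_Icc.exists_bound_of_continuousOn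
    (f := fun θ : ℝ => ((B - A) * (θ • B + (1 - θ) • A)⁻¹).trace) ?_
  have hcramer : ContinuousOn (fun θ : ℝ => ((θ • B + (1 - θ) • A).det)⁻¹ *
      ((B - A) * (θ • B + (1 - θ) • A).adjugate).trace) (Icc 0 1) :=
    (hsegment.matrix_det.continuousOn.inv₀ h).mul
      (continuous_const.matrix_mul hsegment.matrix_adjugate).matrix_trace.continuousOn
  refine hcramer.congr fun θ _ => ?_
  simp only [Matrix.inv_def, Ring.inverse_eq_inv', Matrix.mul_smul, Matrix.trace_smul, smul_eq_mul]

end Det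

section JacobianMatrix

variable {d : ℕ} {F G : Space d → Space d} {x : Space d}

/-- The matrix of the derivative of a vector field in the standard basis. -/
def jacobianMatrix (F : Space d → Space d) (x : Space d) : Matrix (Fin d) (Fin d) ℝ :=
  LinearMap.toMatrix (EuclideanSpace.basisFun (Fin d) ℝ).toBasis
    (EuclideanSpace.basisFun (Fin d) ℝ).toBasis (fderiv ℝ F x)

theorem trace_jacobianMatrix (F : Space d → Space d) (x : Space d) :
    (jacobianMatrix F x).trace = divergence F x := by
  simp [jacobianMatrix, divergence, Matrix.trace, LinearMap.toMatrix_apply]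

theorem det_jacobianMatrix (F : Space d → Space d) (x : Space d) :
    (jacobianMatrix F x).det = (fderiv ℝ F x).det := by
  rw [jacobianMatrix, LinearMap.det_toMatrix, ContinuousLinearMap.det]

theorem jacobianMatrix_congr (h : F =ᶠ[𝓝 x] G) : jacobianMatrix F x = jacobianMatrix G x := by
  rw [jacobianMatrix, jacobianMatrix, h.fderiv_eq]

theorem jacobianMatrix_id (x : Space d) : jacobianMatrix id x = 1 := by
  rw [jacobianMatrix, fderiv_id, ContinuousLinearMap.coe_id, LinearMap.toMatrix_id]

theorem jacobianMatrix_comp (hF : DifferentiableAt ℝ F (G x)) (hG : DifferentiableAt ℝ G x) :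
    jacobianMatrix (F ∘ G) x = jacobianMatrix F (G x) * jacobianMatrix G x := by
  rw [jacobianMatrix, fderiv_comp x hF hG, ContinuousLinearMap.toLinearMap_comp,
    LinearMap.toMatrix_comp _ (EuclideanSpace.basisFun (Fin d) ℝ).toBasis]
  rfl

theorem jacobianMatrix_add (hF : DifferentiableAt ℝ F x) (hG : DifferentiableAt ℝ G x) :
    jacobianMatrix (F + G) x = jacobianMatrix F x + jacobianMatrix G x := by
  simp only [jacobianMatrix, fderiv_add hF hG, ContinuousLinearMap.toLinearMap_add, map_add]

theorem jacobianMatrix_sub (hF : DifferentiableAt ℝ F x) (hG : DifferentiableAt ℝ G x) :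
    jacobianMatrix (F - G) x = jacobianMatrix F x - jacobianMatrix G x := by
  simp only [jacobianMatrix, fderiv_sub hF hG, ContinuousLinearMap.toLinearMap_sub, map_sub]

theorem jacobianMatrix_const_smul (c : ℝ) (hF : DifferentiableAt ℝ F x) :
    jacobianMatrix (c • F) x = c • jacobianMatrix F x := by
  simp only [jacobianMatrix, fderiv_const_smul hF, ContinuousLinearMap.toLinearMap_smul, map_smul]

end JacobianMatrix

theorem exists_hasFDerivAt_of_eqOn_affineMap {E F : Type*} [NormedAddCommGroup E]
    [NormedSpace ℝ E] [FiniteDimensional ℝ E] [NormedAddCommGroup F] [NormedSpace ℝ F]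
    {φ : E → F} {s : Set E} (h : ∃ g : E →ᵃ[ℝ] F, EqOn φ g s) :
    ∃ L : E →L[ℝ] F, ∀ Y ∈ interior s, HasFDerivAt φ L Y := by
  obtain ⟨g, hg⟩ := h
  let g' : E →ᴬ[ℝ] F := ⟨g, g.continuous_of_finiteDimensional⟩
  exact ⟨g'.contLinear, fun Y hY => g'.hasFDerivAt.congr_of_eventuallyEq
    (hg.eventuallyEq_of_mem (mem_interior_iff_mem_nhds.1 hY))⟩

section CellMatrix

variable {d : ℕ} {T : Triangulation d} {φ ψ : Space d → Space d} {K : Finset (Space d)}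
  {x Y : Space d}

/-- The Jacobian matrix on the cell `K` of a map that is affine there. It is evaluated at the
centroid, which lies in the interior of the cell. -/
def cellMatrix (φ : Space d → Space d) (K : Finset (Space d)) : Matrix (Fin d) (Fin d) ℝ :=
  jacobianMatrix φ (K.centroid ℝ id)

theorem differentiableAt_of_eqOn_affineMap
    (hφ : ∃ g : Space d →ᵃ[ℝ] Space d, EqOn φ g (convexHull ℝ (K : Set (Space d))))
    (hY : Y ∈ interior (convexHull ℝ (K : Set (Space d)))) : DifferentiableAt ℝ φ Y :=
  let ⟨_, hL⟩ := exists_hasFDerivAt_of_eqOn_affineMap hφ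
  (hL Y hY).differentiableAt

theorem jacobianMatrix_eq_cellMatrix
    (hφ : ∃ g : Space d →ᵃ[ℝ] Space d, EqOn φ g (convexHull ℝ (K : Set (Space d))))
    (hK : K ∈ T.cells) (hY : Y ∈ interior (convexHull ℝ (K : Set (Space d)))) :
    jacobianMatrix φ Y = cellMatrix φ K := by
  obtain ⟨L, hL⟩ := exists_hasFDerivAt_of_eqOn_affineMap hφ
  rw [cellMatrix, jacobianMatrix, jacobianMatrix, (hL Y hY).fderiv,
    (hL _ (Triangulation.centroid_mem_interior hK)).fderiv]

namespace Triangulation.IsDeformation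

theorem differentiableAt_inverse (h : T.IsDeformation φ) (hK : K ∈ T.cells)
    (hx : x ∈ interior (imageCell φ K)) : DifferentiableAt ℝ (T.inverse φ) x := by
  obtain ⟨e, he⟩ := h.exists_affineEquiv hK
  exact e.symm.toContinuousAffineMap.differentiable.differentiableAt.congr_of_eventuallyEq
    ((h.inverse_eqOn hK he).eventuallyEq_of_mem (mem_interior_iff_mem_nhds.1 hx))

theorem inverse_mem_interior (h : T.IsDeformation φ) (hK : K ∈ T.cells)
    (hx : x ∈ interior (imageCell φ K)) :
    T.inverse φ x ∈ interior (convexHull ℝ (K : Set (Space d))) := by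
  rw [h.interior_imageCell hK] at hx
  obtain ⟨Y, hY, rfl⟩ := hx
  rwa [h.inverse_apply (simplex_subset_region hK (interior_subset hY))]

theorem jacobianMatrix_comp_inverse_eq_mul (h : T.IsDeformation φ) (hK : K ∈ T.cells)
    (hψ : ∃ g : Space d →ᵃ[ℝ] Space d, EqOn ψ g (convexHull ℝ (K : Set (Space d))))
    (hx : x ∈ interior (imageCell φ K)) :
    jacobianMatrix (ψ ∘ T.inverse φ) x = cellMatrix ψ K * jacobianMatrix (T.inverse φ) x := by
  have hY := h.inverse_mem_interior hK hx
  rw [jacobianMatrix_comp (differentiableAt_of_eqOn_affineMap hψ hY)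
    (h.differentiableAt_inverse hK hx), jacobianMatrix_eq_cellMatrix hψ hK hY]

theorem cellMatrix_mul_jacobianMatrix_inverse (h : T.IsDeformation φ) (hK : K ∈ T.cells)
    (hx : x ∈ interior (imageCell φ K)) :
    cellMatrix φ K * jacobianMatrix (T.inverse φ) x = 1 := by
  have hright : φ ∘ T.inverse φ =ᶠ[𝓝 x] id := by
    filter_upwards [mem_interior_iff_mem_nhds.1 hx]
    rintro _ ⟨Y, hY, rfl⟩
    rw [Function.comp_apply, h.inverse_apply (simplex_subset_region hK hY), id]
  rw [← h.jacobianMatrix_comp_inverse_eq_mul hK (h.affine K hK) hx, jacobianMatrix_congr hright,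
    jacobianMatrix_id]

theorem det_cellMatrix_ne_zero (h : T.IsDeformation φ) (hK : K ∈ T.cells) :
    (cellMatrix φ K).det ≠ 0 := by
  obtain ⟨x, hx⟩ := h.interior_imageCell_nonempty hK
  exact (Matrix.isUnit_det_of_right_inverse
    (h.cellMatrix_mul_jacobianMatrix_inverse hK hx)).ne_zero

theorem jacobianMatrix_comp_inverse (h : T.IsDeformation φ) (hK : K ∈ T.cells)
    (hψ : ∃ g : Space d →ᵃ[ℝ] Space d, EqOn ψ g (convexHull ℝ (K : Set (Space d))))
    (hx : x ∈ interior (imageCell φ K)) :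
    jacobianMatrix (ψ ∘ T.inverse φ) x = cellMatrix ψ K * (cellMatrix φ K)⁻¹ := by
  rw [h.jacobianMatrix_comp_inverse_eq_mul hK hψ hx,
    Matrix.inv_eq_right_inv (h.cellMatrix_mul_jacobianMatrix_inverse hK hx)]

theorem integral_imageCell (h : T.IsDeformation φ) (hK : K ∈ T.cells) (F : Space d → ℝ) :
    ∫ x in imageCell φ K, F x = |(cellMatrix φ K).det| *
      ∫ Y in interior (convexHull ℝ (K : Set (Space d))), F (φ Y) := by
  have hderiv (Y : Space d) (hY : Y ∈ interior (convexHull ℝ (K : Set (Space d)))) :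
      HasFDerivWithinAt φ (fderiv ℝ φ Y) (interior (convexHull ℝ (K : Set (Space d)))) Y :=
    (differentiableAt_of_eqOn_affineMap (h.affine K hK) hY).hasFDerivAt.hasFDerivWithinAt
  rw [← setIntegral_congr_set (h.interior_ae_eq_imageCell hK), h.interior_imageCell hK,
    integral_image_eq_integral_abs_det_fderiv_smul volume isOpen_interior.measurableSet hderiv
      (h.injOn.mono (interior_subset.trans (simplex_subset_region hK))), ← integral_const_mul]
  refine setIntegral_congr_fun isOpen_interior.measurableSet fun Y hY => ?_
  rw [smul_eq_mul, ← det_jacobianMatrix, jacobianMatrix_eq_cellMatrix (h.affine K hK) hK hY]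

theorem integral_transfer (h : T.IsDeformation φ) (h' : T.IsDeformation ψ) (hK : K ∈ T.cells)
    (F : Space d → ℝ) :
    ∫ x in imageCell ψ K, F (φ (T.inverse ψ x)) =
      |(cellMatrix ψ K).det / (cellMatrix φ K).det| * ∫ x in imageCell φ K, F x := by
  have hpull : ∫ Y in interior (convexHull ℝ (K : Set (Space d))), F (φ (T.inverse ψ (ψ Y))) =
      ∫ Y in interior (convexHull ℝ (K : Set (Space d))), F (φ Y) :=
    setIntegral_congr_fun isOpen_interior.measurableSet fun Y hY => by
      rw [h'.inverse_apply (simplex_subset_region hK (interior_subset hY))]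
  rw [h'.integral_imageCell hK, h.integral_imageCell hK, hpull, abs_div, ← mul_assoc,
    div_mul_cancel₀ _ (abs_ne_zero.2 (h.det_cellMatrix_ne_zero hK))]

end Triangulation.IsDeformation

end CellMatrix

/-! ### Volume change along the mesh motion -/

namespace ALEMotion

variable {d N : ℕ} (M : ALEMotion d N) {n : ℕ} {K : Finset (Space d)}

theorem interp_zero (n : ℕ) : M.interp n 0 = M.map n := by
  funext Y
  simp [interp]

theorem interp_one (n : ℕ) : M.interp n 1 = M.map (n + 1) := by
  funext Y
  simp [interp]

theorem isDeformation_interp (hn : n < N) {θ : ℝ} (hθ : θ ∈ Icc (0 : ℝ) 1) :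
    M.ref.IsDeformation (M.interp n θ) where
  affine K hK := by
    obtain ⟨g₀, h₀⟩ := M.piecewiseAffine n hn.le K hK
    obtain ⟨g₁, h₁⟩ := M.piecewiseAffine (n + 1) hn K hK
    exact ⟨θ • g₁ + (1 - θ) • g₀, fun Y hY => by simp [interp, h₀ hY, h₁ hY]⟩
  injOn := M.injOn n hn θ hθ

theorem isDeformation_map (hn : n ≤ N) (hN : 0 < N) : M.ref.IsDeformation (M.map n) := by
  rcases n with _ | m
  · rw [← M.interp_zero]
    exact M.isDeformation_interp hN ⟨le_rfl, zero_le_one⟩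
  · rw [← M.interp_one]
    exact M.isDeformation_interp (Nat.lt_of_succ_le hn) ⟨zero_le_one, le_rfl⟩

/-- The value of the Jacobian determinant of `𝒜_{t^n,t^{n+1}}` on the cell `K`. -/
def cellJacobian (n : ℕ) (K : Finset (Space d)) : ℝ :=
  (cellMatrix (M.map (n + 1)) K).det / (cellMatrix (M.map n) K).det

/-- The value on the cell `K` of the divergence of the mesh velocity at the time `t^n + θ Δt`. -/
def cellDivergence (Δt : ℝ) (n : ℕ) (θ : ℝ) (K : Finset (Space d)) : ℝ :=
  Δt⁻¹ * ((cellMatrix (M.map (n + 1)) K - cellMatrix (M.map n) K) *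
    (θ • cellMatrix (M.map (n + 1)) K + (1 - θ) • cellMatrix (M.map n) K)⁻¹).trace

variable {M}

theorem differentiableAt_map_centroid (hn : n ≤ N) (hK : K ∈ M.ref.cells) :
    DifferentiableAt ℝ (M.map n) (K.centroid ℝ id) :=
  differentiableAt_of_eqOn_affineMap (M.piecewiseAffine n hn K hK)
    (Triangulation.centroid_mem_interior hK)

theorem cellMatrix_interp (hn : n < N) (hK : K ∈ M.ref.cells) (θ : ℝ) :
    cellMatrix (M.interp n θ) K =
      θ • cellMatrix (M.map (n + 1)) K + (1 - θ) • cellMatrix (M.map n) K := by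
  have h₀ := differentiableAt_map_centroid hn.le hK
  have h₁ := differentiableAt_map_centroid hn hK
  rw [cellMatrix, cellMatrix, cellMatrix, ← jacobianMatrix_const_smul _ h₀,
    ← jacobianMatrix_const_smul _ h₁,
    ← jacobianMatrix_add (h₁.const_smul θ) (h₀.const_smul (1 - θ))]
  rfl

theorem divergence_stepVelocity (hn : n < N) (hK : K ∈ M.ref.cells) (Δt : ℝ) {θ : ℝ}
    (hθ : θ ∈ Icc (0 : ℝ) 1) {x : Space d} (hx : x ∈ interior (imageCell (M.interp n θ) K)) :
    divergence (M.stepVelocity Δt n θ) x = M.cellDivergence Δt n θ K := by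
  obtain ⟨g₀, h₀⟩ := M.piecewiseAffine n hn.le K hK
  obtain ⟨g₁, h₁⟩ := M.piecewiseAffine (n + 1) hn K hK
  have hvel : M.stepVelocity Δt n θ =
      (Δt⁻¹ • (M.map (n + 1) - M.map n)) ∘ M.ref.inverse (M.interp n θ) := rfl
  have hd₀ := differentiableAt_map_centroid hn.le hK
  have hd₁ := differentiableAt_map_centroid hn hK
  have hcell : cellMatrix (Δt⁻¹ • (M.map (n + 1) - M.map n)) K =
      Δt⁻¹ • (cellMatrix (M.map (n + 1)) K - cellMatrix (M.map n) K) := by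
    rw [cellMatrix, jacobianMatrix_const_smul _ (hd₁.sub hd₀), jacobianMatrix_sub hd₁ hd₀,
      ← cellMatrix, ← cellMatrix]
  rw [← trace_jacobianMatrix, hvel, (M.isDeformation_interp hn hθ).jacobianMatrix_comp_inverse hK
    ⟨Δt⁻¹ • (g₁ - g₀), fun Y hY => by simp [h₀ hY, h₁ hY]⟩ hx, hcell,
    cellMatrix_interp hn hK, Matrix.smul_mul, Matrix.trace_smul, smul_eq_mul, cellDivergence]

theorem jacobian_eq_cellJacobian (hn : n < N) (hK : K ∈ M.ref.cells) {x : Space d}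
    (hx : x ∈ interior (imageCell (M.map n) K)) : M.jacobian n x = M.cellJacobian n K := by
  rw [jacobian, transfer, ← det_jacobianMatrix, mapInv, ← Triangulation.inverse,
    (M.isDeformation_map hn.le (by omega)).jacobianMatrix_comp_inverse hK
      (M.piecewiseAffine (n + 1) hn K hK) hx, Matrix.det_mul, Matrix.det_nonsing_inv,
    Ring.inverse_eq_inv', ← div_eq_mul_inv, cellJacobian]

theorem cellJacobian_ne_zero (hn : n < N) (hK : K ∈ M.ref.cells) : M.cellJacobian n K ≠ 0 :=
  div_ne_zero ((M.isDeformation_map hn (by omega)).det_cellMatrix_ne_zero hK)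
    ((M.isDeformation_map hn.le (by omega)).det_cellMatrix_ne_zero hK)

theorem det_segment_cellMatrix_ne_zero (hn : n < N) (hK : K ∈ M.ref.cells) :
    ∀ θ ∈ Icc (0 : ℝ) 1,
      (θ • cellMatrix (M.map (n + 1)) K + (1 - θ) • cellMatrix (M.map n) K).det ≠ 0 := by
  intro θ hθ
  rw [← cellMatrix_interp hn hK]
  exact (M.isDeformation_interp hn hθ).det_cellMatrix_ne_zero hK

theorem exists_log_cellJacobian_eq (hn : n < N) (hK : K ∈ M.ref.cells) {Δt : ℝ} (hΔt : Δt ≠ 0) :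
    ∃ θ ∈ Ioo (0 : ℝ) 1, Real.log (M.cellJacobian n K) = Δt * M.cellDivergence Δt n θ K := by
  obtain ⟨θ, hθ, heq⟩ := exists_log_det_eq_trace _ _ (det_segment_cellMatrix_ne_zero hn hK)
  exact ⟨θ, hθ, by rw [cellJacobian, heq, cellDivergence, mul_inv_cancel_left₀ hΔt]⟩

theorem exists_abs_cellDivergence_le (hn : n < N) (hK : K ∈ M.ref.cells) (Δt : ℝ) :
    ∃ C, ∀ θ ∈ Icc (0 : ℝ) 1, |M.cellDivergence Δt n θ K| ≤ C := by
  obtain ⟨C, hC⟩ := exists_bound_trace_segment _ _ (det_segment_cellMatrix_ne_zero hn hK)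
  refine ⟨|Δt⁻¹| * C, fun θ hθ => ?_⟩
  rw [cellDivergence, abs_mul]
  exact mul_le_mul_of_nonneg_left (hC θ hθ) (abs_nonneg _)

theorem alpha₁_nonneg (Δt : ℝ) (n : ℕ) : 0 ≤ M.alpha₁ Δt n := by
  cases n <;> simp [alpha₁]

theorem alpha₂_nonneg (Δt : ℝ) (n : ℕ) : 0 ≤ M.alpha₂ Δt n := by
  unfold alpha₂
  split_ifs <;> simp

theorem abs_divergence_le_alpha₁ (hn : n < N) (Δt : ℝ) :
    ∀ᵐ x ∂(volume.restrict (M.domain (n + 1))),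
      |divergence (M.velocity Δt (n + 1)) x| ≤ M.alpha₁ Δt (n + 1) := by
  have hnorm : eLpNorm (divergence (M.velocity Δt (n + 1))) ⊤ (volume.restrict (M.domain (n + 1))) =
      ⨆ K ∈ M.ref.cells, ‖M.cellDivergence Δt n 1 K‖ₑ :=
    (M.isDeformation_map hn (by omega)).eLpNorm_top_imageDomain
      fun K hK x hx => divergence_stepVelocity hn hK Δt ⟨zero_le_one, le_rfl⟩
        (by rwa [M.interp_one])
  have hfin : eLpNorm (divergence (M.velocity Δt (n + 1))) ⊤
      (volume.restrict (M.domain (n + 1))) ≠ ⊤ := by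
    rw [hnorm, ← Finset.sup_eq_iSup]
    exact ((Finset.sup_lt_iff ENNReal.zero_lt_top).2 fun K _ => enorm_lt_top).ne
  filter_upwards [ae_le_eLpNormEssSup (f := divergence (M.velocity Δt (n + 1)))
    (μ := volume.restrict (M.domain (n + 1)))] with x hx
  rw [← eLpNorm_exponent_top] at hx
  simpa [alpha₁] using ENNReal.toReal_mono hfin hx

theorem eLpNorm_jacobian_mul_divergence (hn : n < N) (Δt : ℝ) {θ : ℝ} (hθ : θ ∈ Ioo (0 : ℝ) 1) :
    eLpNorm (fun x => M.jacobian n (M.map n (M.interpInv n θ x)) *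
        divergence (M.stepVelocity Δt n θ) x) ⊤ (volume.restrict (M.interpDomain n θ)) =
      ⨆ K ∈ M.ref.cells, ‖M.cellJacobian n K * M.cellDivergence Δt n θ K‖ₑ := by
  have hθ' := Ioo_subset_Icc_self hθ
  have h := M.isDeformation_interp hn hθ'
  refine h.eLpNorm_top_imageDomain fun K hK x hx => ?_
  have hmem : M.map n (M.interpInv n θ x) ∈ interior (imageCell (M.map n) K) := by
    rw [(M.isDeformation_map hn.le (by omega)).interior_imageCell hK]
    exact mem_image_of_mem _ (h.inverse_mem_interior hK hx)
  rw [jacobian_eq_cellJacobian hn hK hmem, divergence_stepVelocity hn hK Δt hθ' hx]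

theorem abs_cellJacobian_mul_cellDivergence_le_alpha₂ (hn : n < N) (hK : K ∈ M.ref.cells)
    (Δt : ℝ) {θ : ℝ} (hθ : θ ∈ Ioo (0 : ℝ) 1) :
    |M.cellJacobian n K * M.cellDivergence Δt n θ K| ≤ M.alpha₂ Δt n := by
  have hα : M.alpha₂ Δt n = (⨆ θ ∈ Ioo (0 : ℝ) 1, ⨆ K ∈ M.ref.cells,
      ‖M.cellJacobian n K * M.cellDivergence Δt n θ K‖ₑ).toReal := by
    rw [alpha₂, if_pos hn]
    congr 1
    exact iSup_congr fun θ => iSup_congr fun hθ => eLpNorm_jacobian_mul_divergence hn Δt hθ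
  have hfin : (⨆ θ ∈ Ioo (0 : ℝ) 1, ⨆ K ∈ M.ref.cells,
      ‖M.cellJacobian n K * M.cellDivergence Δt n θ K‖ₑ) ≠ ⊤ := by
    choose! C hC using fun K hK => exists_abs_cellDivergence_le (M := M) hn (K := K) hK Δt
    have hsup : (⨆ K ∈ M.ref.cells, ENNReal.ofReal (|M.cellJacobian n K| * C K)) < ⊤ := by
      rw [← Finset.sup_eq_iSup, Finset.sup_lt_iff ENNReal.zero_lt_top]
      exact fun K _ => ENNReal.ofReal_lt_top
    refine ne_top_of_le_ne_top hsup.ne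
      (iSup₂_le fun θ hθ => iSup₂_mono fun K hK => ?_)
    rw [Real.enorm_eq_ofReal_abs, abs_mul]
    exact ENNReal.ofReal_le_ofReal (mul_le_mul_of_nonneg_left
      (hC K hK θ (Ioo_subset_Icc_self hθ)) (abs_nonneg _))
  have hle := (le_iSup₂ (f := fun K (_ : K ∈ M.ref.cells) =>
    ‖M.cellJacobian n K * M.cellDivergence Δt n θ K‖ₑ) K hK).trans
      (le_iSup₂ (f := fun θ (_ : θ ∈ Ioo (0 : ℝ) 1) => ⨆ K ∈ M.ref.cells,
        ‖M.cellJacobian n K * M.cellDivergence Δt n θ K‖ₑ) θ hθ)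
  rw [hα]
  simpa using ENNReal.toReal_mono hfin hle

theorem abs_cellJacobian_le (hn : n < N) (hK : K ∈ M.ref.cells) {Δt : ℝ} (hΔt : 0 < Δt) :
    |M.cellJacobian n K| ≤ 1 + Δt * M.alpha₂ Δt n := by
  obtain ⟨θ, hθ, hlog⟩ := exists_log_cellJacobian_eq hn hK hΔt.ne'
  have hJ : 0 < |M.cellJacobian n K| := abs_pos.2 (cellJacobian_ne_zero hn hK)
  calc |M.cellJacobian n K|
      = 1 + |M.cellJacobian n K| * (1 - |M.cellJacobian n K|⁻¹) := by field_simp; ring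
    _ ≤ 1 + |M.cellJacobian n K| * Real.log |M.cellJacobian n K| := by
      gcongr
      exact Real.one_sub_inv_le_log_of_pos hJ
    _ = 1 + Δt * (|M.cellJacobian n K| * M.cellDivergence Δt n θ K) := by
      rw [Real.log_abs, hlog]
      ring
    _ ≤ 1 + Δt * |M.cellJacobian n K * M.cellDivergence Δt n θ K| := by
      rw [abs_mul]
      gcongr
      exact le_abs_self _
    _ ≤ 1 + Δt * M.alpha₂ Δt n := by
      gcongr
      exact abs_cellJacobian_mul_cellDivergence_le_alpha₂ hn hK Δt hθ

theorem normSq_nonneg (n : ℕ) (v : Space d → ℝ) : 0 ≤ M.normSq n v :=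
  integral_nonneg fun _ => sq_nonneg _

theorem continuousOn_comp_transfer {m n : ℕ} (hm : m ≤ N) (hn : n ≤ N) (hN : 0 < N)
    {v : Space d → ℝ} (hv : ContinuousOn v (closure (M.domain n))) :
    ContinuousOn (fun x => v (M.transfer m n x)) (closure (M.domain m)) :=
  (M.isDeformation_map hn hN).continuousOn_transfer (M.isDeformation_map hm hN) hv

theorem memLp_of_continuousOn (hn : n ≤ N) (hN : 0 < N) {E : Type*} [NormedAddCommGroup E]
    {v : Space d → E} (hv : ContinuousOn v (closure (M.domain n))) (p : ℝ≥0∞) :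
    MemLp v p (volume.restrict (M.domain n)) :=
  (M.isDeformation_map hn hN).memLp_of_continuousOn hv p

theorem restrict_cell_le (hn : n ≤ N) (hN : 0 < N) (hK : K ∈ M.ref.cells) :
    volume.restrict (M.cell n K) ≤ volume.restrict (M.domain n) :=
  (M.isDeformation_map hn hN).restrict_imageCell_le hK

theorem setIntegral_domain (hn : n ≤ N) (hN : 0 < N) {f : Space d → ℝ}
    (hf : Integrable f (volume.restrict (M.domain n))) :
    ∫ x in M.domain n, f x = ∑ K ∈ M.ref.cells, ∫ x in M.cell n K, f x :=
  (M.isDeformation_map hn hN).integral_imageDomain hf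

theorem setIntegral_cell_transfer (hn : n < N) (hK : K ∈ M.ref.cells) (F : Space d → ℝ) :
    ∫ x in M.cell (n + 1) K, F (M.transfer (n + 1) n x) =
      |M.cellJacobian n K| * ∫ x in M.cell n K, F x :=
  (M.isDeformation_map hn.le (by omega)).integral_transfer
    (M.isDeformation_map hn (by omega)) hK F

theorem normSq_transfer_le (hn : n < N) {Δt : ℝ} (hΔt : 0 < Δt) {v : Space d → ℝ}
    (hv : ContinuousOn v (closure (M.domain n))) :
    M.normSq (n + 1) (fun x => v (M.transfer (n + 1) n x)) ≤
      (1 + Δt * M.alpha₂ Δt n) * M.normSq n v := by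
  have hN : 0 < N := by omega
  have hold := (memLp_of_continuousOn hn.le hN hv 2).integrable_sq
  have hnew := (memLp_of_continuousOn hn hN
    (continuousOn_comp_transfer hn hn.le hN hv) 2).integrable_sq
  rw [normSq, normSq, setIntegral_domain hn hN hnew,
    setIntegral_domain hn.le hN hold, Finset.mul_sum]
  refine Finset.sum_le_sum fun K hK => ?_
  rw [setIntegral_cell_transfer hn hK fun y => v y ^ 2]
  exact mul_le_mul_of_nonneg_right (abs_cellJacobian_le hn hK hΔt)
    (integral_nonneg fun _ => sq_nonneg _)

end ALEMotion

/-! ### Convection and reaction -/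

theorem dist_le_mul_sub_of_frequently_dist_le {F : Type*} [PseudoMetricSpace F] {f : ℝ → F}
    {a b κ : ℝ} (hf : ContinuousOn f (Icc a b))
    (hκ : ∀ t ∈ Ico a b, ∃ᶠ r in 𝓝[>] t, dist (f t) (f r) ≤ κ * (r - t)) :
    ∀ t ∈ Icc a b, dist (f a) (f t) ≤ κ * (t - a) := by
  intro t ht
  refine image_le_of_liminf_slope_right_le_deriv_boundary (f := fun t => dist (f a) (f t))
    (B := fun t => κ * (t - a)) (B' := fun _ => κ) (continuous_dist.comp_continuousOn
      (continuousOn_const.prodMk hf)) (by simp) (by fun_prop) (fun x _ => ?_)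
    (fun x hx m hm => ?_) ht
  · simpa using (((hasDerivAt_id x).sub_const a).const_mul κ).hasDerivWithinAt
  · refine ((hκ x hx).and_eventually self_mem_nhdsWithin).mono fun r hr => ?_
    have hxr : 0 < r - x := sub_pos.2 hr.2
    rw [slope_def_field, div_lt_iff₀ hxr]
    linarith [dist_triangle (f a) (f x) (f r), hr.1, mul_lt_mul_of_pos_right hm hxr]

theorem lipschitzOnWith_of_finite_closed_cover {E F ι : Type*} [NormedAddCommGroup E]
    [NormedSpace ℝ E] [PseudoMetricSpace F] [Finite ι] {f : E → F} {s : Set E} (hs : Convex ℝ s)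
    (hf : ContinuousOn f s) {C : ι → Set E} (hC : ∀ i, IsClosed (C i)) (hcov : s ⊆ ⋃ i, C i)
    {κ : ℝ≥0} (hLip : ∀ i, LipschitzOnWith κ f (C i ∩ s)) : LipschitzOnWith κ f s := by
  refine LipschitzOnWith.of_dist_le_mul fun x hx y hy => ?_
  set γ : ℝ → E := fun t => AffineMap.lineMap x y t with hγ
  have hγc : Continuous γ := AffineMap.lineMap_continuous
  have hγs : ∀ t ∈ Icc (0 : ℝ) 1, γ t ∈ s := fun t ht => hs.lineMap_mem hx hy ht
  have hlocal : ∀ t ∈ Ico (0 : ℝ) 1,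
      ∃ᶠ r in 𝓝[>] t, dist (f (γ t)) (f (γ r)) ≤ κ * dist x y * (r - t) := by
    intro t ht
    have hnear : ∀ᶠ r in 𝓝[>] t, r ∈ Ioo t 1 := Ioo_mem_nhdsGT ht.2
    have hIcc : ∀ r ∈ Ioo t 1, r ∈ Icc (0 : ℝ) 1 := fun r hr =>
      ⟨ht.1.trans hr.1.le, hr.2.le⟩
    obtain ⟨i, hi⟩ : ∃ i, ∃ᶠ r in 𝓝[>] t, γ r ∈ C i := frequently_exists.1
      (hnear.frequently.mono fun r hr => mem_iUnion.1 (hcov (hγs r (hIcc r hr))))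
    have hti : γ t ∈ C i := (hC i).mem_of_frequently_of_tendsto hi
      ((hγc.tendsto t).mono_left nhdsWithin_le_nhds)
    refine (hi.and_eventually hnear).mono fun r hr => ?_
    have hdist : dist (γ t) (γ r) = (r - t) * dist x y := by
      rw [hγ, dist_lineMap_lineMap, Real.dist_eq, abs_sub_comm, abs_of_pos (sub_pos.2 hr.2.1)]
    calc dist (f (γ t)) (f (γ r)) ≤ κ * dist (γ t) (γ r) := (hLip i).dist_le_mul _
          ⟨hti, hγs t (Ico_subset_Icc_self ht)⟩ _ ⟨hr.1, hγs r (hIcc r hr.2)⟩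
      _ = κ * dist x y * (r - t) := by rw [hdist]; ring
  have := dist_le_mul_sub_of_frequently_dist_le (f := f ∘ γ)
    (hf.comp hγc.continuousOn hγs) hlocal 1 (right_mem_Icc.2 zero_le_one)
  simpa [hγ] using this

section Convection

variable {d : ℕ} {U : Set (Space d)} {B : Space d → Space d} {κ κ' : ℝ≥0}

theorem lipschitzWith_component (hB : LipschitzWith κ B) (i : Fin d) :
    LipschitzWith κ fun x => B x i :=
  LipschitzWith.of_dist_le_mul fun x y => by
    refine le_trans ?_ (hB.dist_le_mul x y)
    rw [dist_eq_norm, dist_eq_norm]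
    exact PiLp.norm_apply_le (B x - B y) i

theorem divergence_eq_sum_lineDeriv {x : Space d} (hB : DifferentiableAt ℝ B x) :
    divergence B x =
      ∑ i, lineDeriv ℝ (fun y => B y i) x (EuclideanSpace.single i 1) := by
  refine Finset.sum_congr rfl fun i _ => ?_
  have hBi : HasFDerivAt (fun y => B y i)
      ((EuclideanSpace.proj i : Space d →L[ℝ] ℝ).comp (fderiv ℝ B x)) x :=
    (EuclideanSpace.proj i : Space d →L[ℝ] ℝ).hasFDerivAt.comp x hB.hasFDerivAt
  rw [hBi.differentiableAt.lineDeriv_eq_fderiv, hBi.fderiv]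
  rfl

theorem divergence_congr {B' : Space d → Space d} {x : Space d} (h : B =ᶠ[𝓝 x] B') :
    divergence B x = divergence B' x := by
  simp only [divergence, h.fderiv_eq]

theorem measurable_divergence (B : Space d → Space d) : Measurable (divergence B) :=
  Finset.measurable_sum _ fun i _ =>
    (EuclideanSpace.proj i : Space d →L[ℝ] ℝ).continuous.measurable.comp
      (measurable_fderiv_apply_const ℝ B (EuclideanSpace.single i 1))

theorem norm_divergence_le (hB : LipschitzWith κ B) (x : Space d) :
    ‖divergence B x‖ ≤ d * κ := by
  have hterm (i : Fin d) : ‖fderiv ℝ B x (EuclideanSpace.single i 1) i‖ ≤ κ :=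
    calc ‖fderiv ℝ B x (EuclideanSpace.single i 1) i‖
        ≤ ‖fderiv ℝ B x (EuclideanSpace.single i 1)‖ := PiLp.norm_apply_le _ i
      _ ≤ ‖fderiv ℝ B x‖ * ‖EuclideanSpace.single i (1 : ℝ)‖ := (fderiv ℝ B x).le_opNorm _
      _ ≤ κ := by simpa using norm_fderiv_le_of_lipschitz ℝ hB
  simpa [divergence] using norm_sum_le_of_le Finset.univ fun i _ => hterm i

theorem apply_eq_sum_single (L : Space d →L[ℝ] ℝ) (x : Space d) :
    L x = ∑ i, L (x i • EuclideanSpace.single i 1) := by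
  rw [← map_sum]
  congr 1
  simpa using ((EuclideanSpace.basisFun (Fin d) ℝ).sum_repr x).symm

theorem aestronglyMeasurable_fderiv_apply {g : Space d → ℝ} {ν : Measure (Space d)}
    (hB : AEStronglyMeasurable B ν) :
    AEStronglyMeasurable (fun x => fderiv ℝ g x (B x)) ν :=
  (ContinuousLinearMap.apply ℝ ℝ : Space d →L[ℝ] (Space d →L[ℝ] ℝ) →L[ℝ] ℝ).flip
    |>.aestronglyMeasurable_comp₂ (measurable_fderiv ℝ g).aestronglyMeasurable hB

theorem integrable_fderiv_apply {g : Space d → ℝ} (hB : Continuous B) (hg : LipschitzWith κ g)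
    (hgs : HasCompactSupport g) : Integrable fun x => fderiv ℝ g x (B x) := by
  have hsupp : Function.support (fun x => fderiv ℝ g x (B x)) ⊆ tsupport g := fun x hx =>
    support_fderiv_subset ℝ fun h => hx (by simp [h])
  rw [← integrableOn_iff_integrable_of_support_subset hsupp]
  obtain ⟨C, hC⟩ := hgs.isCompact.exists_bound_of_continuousOn hB.continuousOn
  refine Measure.integrableOn_of_bounded (M := κ * C) hgs.measure_lt_top.ne
    (aestronglyMeasurable_fderiv_apply hB.aestronglyMeasurable)
    (ae_restrict_of_forall_mem hgs.isCompact.measurableSet fun x hx => ?_)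
  exact ((fderiv ℝ g x).le_opNorm _).trans (mul_le_mul (norm_fderiv_le_of_lipschitz ℝ hg)
    (hC x hx) (norm_nonneg _) κ.2)

theorem integral_divergence_mul {g : Space d → ℝ} (hB : LipschitzWith κ B)
    (hg : LipschitzWith κ' g) (hgs : HasCompactSupport g) :
    ∫ x, divergence B x * g x = -∫ x, fderiv ℝ g x (B x) := by
  set e : Fin d → Space d := fun i => EuclideanSpace.single i 1 with he
  have hBi := lipschitzWith_component hB
  have hleft (i : Fin d) : Integrable fun x => lineDeriv ℝ (fun y => B y i) x (e i) * g x :=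
    ((hBi i).memLp_lineDeriv (e i)).integrable_mul
      (memLp_one_iff_integrable.2 (hg.continuous.integrable_of_hasCompactSupport hgs))
  have hright (i : Fin d) : Integrable fun x => fderiv ℝ g x (B x i • e i) :=
    integrable_fderiv_apply ((hBi i).continuous.smul continuous_const) hg hgs
  calc ∫ x, divergence B x * g x
      = ∫ x, ∑ i, lineDeriv ℝ (fun y => B y i) x (e i) * g x := by
        refine integral_congr_ae ?_
        filter_upwards [hB.ae_differentiableAt] with x hx
        rw [divergence_eq_sum_lineDeriv hx, Finset.sum_mul]
    _ = ∑ i, ∫ x, lineDeriv ℝ g x (-e i) * B x i := by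
        rw [integral_finsetSum _ fun i _ => hleft i]
        exact Finset.sum_congr rfl fun i _ => (hBi i).integral_lineDeriv_mul_eq hg hgs _
    _ = ∑ i, -∫ x, fderiv ℝ g x (B x i • e i) := by
        refine Finset.sum_congr rfl fun i _ => ?_
        rw [← integral_neg]
        refine integral_congr_ae ?_
        filter_upwards [hg.ae_differentiableAt] with x hx
        rw [hx.lineDeriv_eq_fderiv, map_neg, map_smul, smul_eq_mul, neg_mul, mul_comm]
    _ = -∫ x, fderiv ℝ g x (B x) := by
        rw [Finset.sum_neg_distrib, ← integral_finsetSum _ fun i _ => hright i]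
        simp only [he, ← apply_eq_sum_single]

theorem exists_lipschitzWith_sq {w : Space d → ℝ} (hw : LipschitzWith κ w)
    (hws : HasCompactSupport w) : ∃ κ', LipschitzWith κ' fun x => w x ^ 2 := by
  obtain ⟨R, hR⟩ := hw.continuous.bounded_above_of_compact_support hws
  obtain ⟨κ', hκ'⟩ := (contDiff_id.pow 2 : ContDiff ℝ 1 fun y : ℝ => y ^ 2).contDiffOn
    |>.exists_lipschitzOnWith one_ne_zero (convex_Icc (-R) R) isCompact_Icc
  exact ⟨κ' * κ, lipschitzOnWith_univ.1
    (hκ'.comp (lipschitzOnWith_univ.2 hw) fun x _ => abs_le.1 (hR x))⟩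

theorem hasCompactSupport_sq {w : Space d → ℝ} (hws : HasCompactSupport w) :
    HasCompactSupport fun x => w x ^ 2 :=
  hws.comp_left (g := fun y : ℝ => y ^ 2) (by norm_num)

theorem integrable_mul_sq {c w : Space d → ℝ} (hc : MemLp c ⊤ (volume.restrict U))
    (hw : Continuous w) (hws : HasCompactSupport w) :
    Integrable (fun x => c x * w x ^ 2) (volume.restrict U) :=
  hc.integrable_mul (memLp_one_iff_integrable.2
    ((hw.pow 2).integrable_of_hasCompactSupport (hasCompactSupport_sq hws)).integrableOn)

theorem integral_fderiv_apply_mul_self {w : Space d → ℝ} (hB : LipschitzWith κ B)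
    (hw : LipschitzWith κ' w) (hws : HasCompactSupport w) :
    ∫ x, fderiv ℝ w x (B x) * w x = -(1 / 2) * ∫ x, divergence B x * w x ^ 2 := by
  obtain ⟨κ'', hsq⟩ := exists_lipschitzWith_sq hw hws
  have hchain : ∫ x, fderiv ℝ (fun x => w x ^ 2) x (B x) =
      2 * ∫ x, fderiv ℝ w x (B x) * w x := by
    rw [← integral_const_mul]
    refine integral_congr_ae ?_
    filter_upwards [hw.ae_differentiableAt] with x hx
    rw [(hx.hasFDerivAt.pow 2).fderiv]
    simp only [smul_apply, smul_eq_mul]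
    ring
  rw [integral_divergence_mul hB hsq (hasCompactSupport_sq hws), hchain]
  ring

theorem exists_lipschitzWith_eventuallyEq {K : Set (Space d)} (hU : IsOpen U) (hK : IsCompact K)
    (hKU : K ⊆ U) (hB : LocallyLipschitzOn U B) :
    ∃ (κ : ℝ≥0) (B' : Space d → Space d), LipschitzWith κ B' ∧ ∀ x ∈ K, B' =ᶠ[𝓝 x] B := by
  obtain ⟨L, hL, hKL, hLU⟩ := exists_compact_between hK hU hKU
  obtain ⟨κB, hκB⟩ := LocallyLipschitzOn.exists_lipschitzOnWith_of_compact hL (hB.mono hLU)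
  obtain ⟨B', hB', hBB'⟩ := hκB.extend_finite_dimension
  refine ⟨_, B', hB', fun x hx => ?_⟩
  filter_upwards [isOpen_interior.mem_nhds (hKL hx)] with y hy
  exact (hBB' (interior_subset hy)).symm

theorem integral_convection_reaction_nonneg_of_tsupport_subset (hU : IsOpen U)
    {w c : Space d → ℝ} (hw : LipschitzWith κ w) (hws : HasCompactSupport w)
    (hwU : tsupport w ⊆ U) (hB : LocallyLipschitzOn U B) (hc : MemLp c ⊤ (volume.restrict U))
    (hcB : ∀ᵐ x ∂(volume.restrict U), 0 ≤ c x - 1 / 2 * divergence B x) :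
    0 ≤ ∫ x in U, (fderiv ℝ w x (B x) * w x + c x * w x ^ 2) := by
  obtain ⟨κB, B', hB', hBB'⟩ := exists_lipschitzWith_eventuallyEq hU hws.isCompact hwU hB
  have hw0 : ∀ x ∉ tsupport w, w x = 0 := fun x hx => image_eq_zero_of_notMem_tsupport hx
  have hcongr (x : Space d) : fderiv ℝ w x (B x) * w x = fderiv ℝ w x (B' x) * w x := by
    by_cases hx : x ∈ tsupport w
    · rw [(hBB' x hx).eq_of_nhds]
    · rw [hw0 x hx, mul_zero, mul_zero]
  have hconv : Integrable fun x => fderiv ℝ w x (B' x) * w x := by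
    refine (integrable_fderiv_apply (hw.continuous.smul hB'.continuous) hw hws).congr
      (.of_forall fun x => ?_)
    simp only [Pi.smul_apply', map_smul, smul_eq_mul, mul_comm]
  have hdiv : Integrable fun x => divergence B' x * w x ^ 2 :=
    ((hw.continuous.pow 2).integrable_of_hasCompactSupport (hasCompactSupport_sq hws)).bdd_mul
      (measurable_divergence B').aestronglyMeasurable
      (.of_forall (norm_divergence_le hB'))
  have hreac := integrable_mul_sq hc hw.continuous hws
  have hparts : ∫ x in U, fderiv ℝ w x (B' x) * w x =
      -(1 / 2) * ∫ x in U, divergence B' x * w x ^ 2 := by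
    rw [setIntegral_eq_integral_of_forall_compl_eq_zero fun x hx => by
        rw [hw0 x fun h => hx (hwU h), mul_zero],
      setIntegral_eq_integral_of_forall_compl_eq_zero fun x hx => by
        rw [hw0 x fun h => hx (hwU h)]; ring]
    exact integral_fderiv_apply_mul_self hB' hw hws
  simp only [hcongr]
  rw [integral_add hconv.integrableOn hreac, hparts, ← integral_const_mul,
    ← integral_add (hdiv.integrableOn.const_mul _) hreac]
  refine integral_nonneg_of_ae ?_
  filter_upwards [hcB] with x hx
  by_cases hxw : x ∈ tsupport w
  · rw [← divergence_congr (hBB' x hxw)] at hx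
    calc (0 : ℝ) ≤ (c x - 1 / 2 * divergence B' x) * w x ^ 2 := mul_nonneg hx (sq_nonneg _)
      _ = -(1 / 2) * (divergence B' x * w x ^ 2) + c x * w x ^ 2 := by ring
  · simp [hw0 x hxw]

/-- Soft thresholding, which moves `y` by at most `s` towards `0`. It is used to push the support
of a function that vanishes on the boundary into the interior without changing its gradient
elsewhere. -/
def softThreshold (s y : ℝ) : ℝ := y - max (-s) (min y s)

theorem softThreshold_eq_zero {s y : ℝ} (h : |y| ≤ s) : softThreshold s y = 0 := by
  rw [softThreshold, min_eq_left (abs_le.1 h).2, max_eq_right (abs_le.1 h).1, sub_self]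

theorem softThreshold_zero (y : ℝ) : softThreshold 0 y = y := by
  simp [softThreshold]

theorem continuous_softThreshold (y : ℝ) : Continuous fun s => softThreshold s y := by
  unfold softThreshold
  fun_prop

theorem abs_softThreshold_le {s : ℝ} (hs : 0 ≤ s) (y : ℝ) : |softThreshold s y| ≤ |y| := by
  unfold softThreshold
  grind

theorem lipschitzWith_softThreshold (s : ℝ) : LipschitzWith 2 (softThreshold s) := by
  have h := LipschitzWith.id.sub ((LipschitzWith.id.min_const s).const_max (-s))
  rwa [one_add_one_eq_two] at h

theorem softThreshold_eventuallyEq_sub_const {s y : ℝ} (hs : 0 ≤ s) (hy : s < |y|) :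
    ∃ a, softThreshold s =ᶠ[𝓝 y] fun z => z - a := by
  rcases lt_abs.1 hy with hy | hy
  · refine ⟨s, ?_⟩
    filter_upwards [lt_mem_nhds hy] with z hz
    rw [softThreshold, min_eq_right hz.le, max_eq_right (by linarith)]
  · refine ⟨-s, ?_⟩
    filter_upwards [gt_mem_nhds (lt_neg_of_lt_neg hy)] with z hz
    rw [softThreshold, min_eq_left (by linarith), max_eq_left hz.le]

theorem fderiv_softThreshold_comp_mul {u : Space d → ℝ} (hu : Continuous u) {s : ℝ} (hs : 0 ≤ s)
    (x v : Space d) :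
    fderiv ℝ (fun x => softThreshold s (u x)) x v * softThreshold s (u x) =
      fderiv ℝ u x v * softThreshold s (u x) := by
  by_cases hx : |u x| ≤ s
  · rw [softThreshold_eq_zero hx, mul_zero, mul_zero]
  · obtain ⟨a, ha⟩ := softThreshold_eventuallyEq_sub_const hs (not_le.1 hx)
    have hev : (fun x => softThreshold s (u x)) =ᶠ[𝓝 x] fun x => u x - a :=
      hu.continuousAt.eventually ha
    rw [hev.fderiv_eq, fderiv_sub_const]

theorem tsupport_softThreshold_comp_subset {u : Space d → ℝ} (hu : Continuous u) {s : ℝ}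
    (hs : 0 < s) (huU : ∀ x ∉ U, u x = 0) :
    tsupport (fun x => softThreshold s (u x)) ⊆ U := by
  have hle : tsupport (fun x => softThreshold s (u x)) ⊆ {x | s ≤ |u x|} := by
    refine closure_minimal (fun x hx => ?_) (isClosed_le continuous_const hu.abs)
    by_contra hlt
    exact hx (softThreshold_eq_zero (not_le.1 hlt).le)
  refine fun x hx => by_contra fun hxU => ?_
  have hxs : s ≤ |u x| := hle hx
  rw [huU x hxU, abs_zero] at hxs
  exact hs.not_ge hxs

theorem tendsto_integral_softThreshold {X : Type*} [TopologicalSpace X] [MeasurableSpace X]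
    [BorelSpace X] {ν : Measure X} {u g c : X → ℝ} {s : ℕ → ℝ} (hu : Continuous u)
    (hg : AEStronglyMeasurable g ν) (hc : AEStronglyMeasurable c ν)
    (hgu : Integrable (fun x => g x * u x) ν) (hcu : Integrable (fun x => c x * u x ^ 2) ν)
    (hs : ∀ n, 0 ≤ s n) (hs0 : Tendsto s atTop (𝓝 0)) :
    Tendsto (fun n => ∫ x, (g x * softThreshold (s n) (u x) +
        c x * softThreshold (s n) (u x) ^ 2) ∂ν) atTop
      (𝓝 (∫ x, (g x * u x + c x * u x ^ 2) ∂ν)) := by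
  have hw (n : ℕ) : Continuous fun x => softThreshold (s n) (u x) :=
    (lipschitzWith_softThreshold _).continuous.comp hu
  refine tendsto_integral_of_dominated_convergence _ (fun n =>
    (hg.mul (hw n).aestronglyMeasurable).add (hc.mul ((hw n).pow 2).aestronglyMeasurable))
    (hgu.norm.add hcu.norm) (fun n => .of_forall fun x => ?_) (.of_forall fun x => ?_)
  · have hle : ‖softThreshold (s n) (u x)‖ ≤ ‖u x‖ := abs_softThreshold_le (hs n) _
    refine (norm_add_le _ _).trans ?_
    simp only [Pi.add_apply, norm_mul, norm_pow]
    gcongr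
  · have hwx : Tendsto (fun n => softThreshold (s n) (u x)) atTop (𝓝 (u x)) := by
      simpa only [Function.comp_def, softThreshold_zero] using
        ((continuous_softThreshold (u x)).tendsto 0).comp hs0
    exact (hwx.const_mul _).add ((hwx.pow 2).const_mul _)

theorem integral_convection_reaction_nonneg (hU : IsOpen U) {u c : Space d → ℝ}
    (hu : LipschitzWith κ u) (hus : HasCompactSupport u) (huU : ∀ x ∉ U, u x = 0)
    (hB : LocallyLipschitzOn U B) {C : ℝ} (hBC : ∀ x ∈ U, ‖B x‖ ≤ C)
    (hc : MemLp c ⊤ (volume.restrict U))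
    (hcB : ∀ᵐ x ∂(volume.restrict U), 0 ≤ c x - 1 / 2 * divergence B x) :
    0 ≤ ∫ x in U, (fderiv ℝ u x (B x) * u x + c x * u x ^ 2) := by
  let s : ℕ → ℝ := fun n => 1 / ((n : ℝ) + 1)
  have hs : ∀ n, 0 < s n := fun n => Nat.one_div_pos_of_nat
  have htrunc (n : ℕ) : 0 ≤ ∫ x in U, (fderiv ℝ u x (B x) * softThreshold (s n) (u x) +
      c x * softThreshold (s n) (u x) ^ 2) := by
    have hw : LipschitzWith (2 * κ) fun x => softThreshold (s n) (u x) :=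
      (lipschitzWith_softThreshold _).comp hu
    have := integral_convection_reaction_nonneg_of_tsupport_subset hU hw
      (hus.comp_left (softThreshold_eq_zero (by simpa using (hs n).le)))
      (tsupport_softThreshold_comp_subset hu.continuous (hs n) huU) hB hc hcB
    simpa only [fderiv_softThreshold_comp_mul hu.continuous (hs _).le] using this
  have hBm : AEStronglyMeasurable (fun x => fderiv ℝ u x (B x)) (volume.restrict U) :=
    aestronglyMeasurable_fderiv_apply
      (hB.continuousOn.aestronglyMeasurable hU.measurableSet)
  have hBb : ∀ᵐ x ∂(volume.restrict U), ‖fderiv ℝ u x (B x)‖ ≤ κ * C :=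
    ae_restrict_of_forall_mem hU.measurableSet fun x hx =>
      ((fderiv ℝ u x).le_opNorm _).trans (mul_le_mul (norm_fderiv_le_of_lipschitz ℝ hu)
        (hBC x hx) (norm_nonneg _) κ.2)
  have hconv : Integrable (fun x => fderiv ℝ u x (B x) * u x) (volume.restrict U) :=
    (hu.continuous.integrable_of_hasCompactSupport hus).integrableOn.bdd_mul hBm hBb
  have hreac := integrable_mul_sq hc hu.continuous hus
  exact ge_of_tendsto' (tendsto_integral_softThreshold hu.continuous hBm hc.1 hconv hreac
    (fun n => (hs n).le) tendsto_one_div_add_atTop_nhds_zero_nat) htrunc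

end Convection

/-! ### Finite element functions -/

section FiniteElement

variable {d N : ℕ}

theorem memLp_inner {X E : Type*} [MeasurableSpace X] {ν : Measure X} [NormedAddCommGroup E]
    [InnerProductSpace ℝ E] {F G : X → E} {p : ℝ≥0∞} (hF : MemLp F ⊤ ν) (hG : MemLp G p ν) :
    MemLp (fun x => inner ℝ (F x) (G x)) p ν :=
  MemLp.of_bilin (fun x y => inner ℝ x y) 1 hF hG (hF.1.inner hG.1)
    (.of_forall fun x => by simpa using nnnorm_inner_le_nnnorm (𝕜 := ℝ) (F x) (G x))

theorem contDiff_mvPolynomial_eval (p : MvPolynomial (Fin d) ℝ) :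
    ContDiff ℝ 2 fun x : Space d => MvPolynomial.eval (fun i => x i) p :=
  (AnalyticOnNhd.eval_continuousLinearMap'
    (fun i => (EuclideanSpace.proj i : Space d →L[ℝ] ℝ)) p).contDiff

theorem continuous_laplacian {f : Space d → ℝ} (hf : ContDiff ℝ 2 f) :
    Continuous (Laplacian.laplacian f) := by
  rw [InnerProductSpace.laplacian_eq_iteratedFDeriv_orthonormalBasis f
    (EuclideanSpace.basisFun (Fin d) ℝ)]
  exact continuous_finsetSum _ fun i _ =>
    (ContinuousMultilinearMap.apply ℝ (fun _ : Fin 2 => Space d) ℝ _).continuous.comp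
      (hf.continuous_iteratedFDeriv (m := 2) le_rfl)

theorem measurable_gradient (v : Space d → ℝ) : Measurable (gradient v) :=
  (InnerProductSpace.toDual ℝ (Space d)).symm.continuous.measurable.comp (measurable_fderiv ℝ v)

theorem indicator_closure_eq_zero {D : Set (Space d)} {v : Space d → ℝ}
    (hv : ∀ x ∈ frontier D, v x = 0) {x : Space d} (hx : x ∉ interior D) :
    (closure D).indicator v x = 0 :=
  indicator_apply_eq_zero.2 fun hmem => hv x ⟨hmem, hx⟩

namespace Triangulation.IsDeformation

variable {T : Triangulation d} {φ : Space d → Space d} {E : Type*} [NormedAddCommGroup E]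

theorem ae_mem_interior_imageDomain (h : T.IsDeformation φ) :
    ∀ᵐ x ∂(volume.restrict (T.imageDomain φ)), x ∈ interior (T.imageDomain φ) := by
  rw [← Measure.restrict_congr_set h.interior_imageDomain_ae_eq]
  exact ae_restrict_mem isOpen_interior.measurableSet

theorem memLp_top_of_continuousOn_interior {F : Space d → Space d} (h : T.IsDeformation φ)
    (hF : ContinuousOn F (interior (T.imageDomain φ))) {C : ℝ}
    (hC : ∀ x ∈ interior (T.imageDomain φ), ‖F x‖ ≤ C) :
    MemLp F ⊤ (volume.restrict (T.imageDomain φ)) := by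
  refine memLp_top_of_bound ?_ C (h.ae_mem_interior_imageDomain.mono hC)
  rw [← Measure.restrict_congr_set h.interior_imageDomain_ae_eq]
  exact hF.aestronglyMeasurable isOpen_interior.measurableSet

theorem exists_forall_lipschitzOnWith [NormedSpace ℝ E] (h : T.IsDeformation φ)
    {F : Space d → E} (hF : ∀ K ∈ T.cells, ∃ g : Space d → E, ContDiff ℝ 2 g ∧
      EqOn F g (imageCell φ K)) :
    ∃ κ, ∀ K ∈ T.cells, LipschitzOnWith κ F (imageCell φ K) := by
  have hcell (K) (hK : K ∈ T.cells) : ∃ κ, LipschitzOnWith κ F (imageCell φ K) := by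
    obtain ⟨g, hg, hFg⟩ := hF K hK
    obtain ⟨κ, hκ⟩ := hg.contDiffOn.exists_lipschitzOnWith two_ne_zero (h.convex_imageCell hK)
      (h.isCompact_imageCell hK)
    refine ⟨κ, fun x hx y hy => ?_⟩
    rw [hFg hx, hFg hy]
    exact hκ hx hy
  choose! κ hκ using hcell
  exact ⟨∑ K ∈ T.cells, κ K, fun K hK => (hκ K hK).weaken
    (Finset.single_le_sum (fun _ _ => zero_le) hK)⟩

theorem locallyLipschitzOn_interior [NormedSpace ℝ E] (h : T.IsDeformation φ) {F : Space d → E}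
    (hF : ContinuousOn F (closure (T.imageDomain φ))) {κ : ℝ≥0}
    (hLip : ∀ K ∈ T.cells, LipschitzOnWith κ F (imageCell φ K)) :
    LocallyLipschitzOn (interior (T.imageDomain φ)) F := by
  intro x hx
  obtain ⟨r, hr, hball⟩ := Metric.isOpen_iff.1 isOpen_interior x hx
  have hsub : Metric.ball x r ⊆ closure (T.imageDomain φ) :=
    hball.trans (interior_subset.trans subset_closure)
  refine ⟨κ, Metric.ball x r, mem_nhdsWithin_of_mem_nhds (Metric.ball_mem_nhds x hr), ?_⟩
  exact lipschitzOnWith_of_finite_closed_cover (convex_ball x r) (hF.mono hsub)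
    (fun K : T.cells => (h.isCompact_imageCell K.2).isClosed)
    (by rwa [h.closure_imageDomain, T.image_region] at hsub)
    fun K => (hLip K K.2).mono inter_subset_left

theorem lipschitzWith_indicator (h : T.IsDeformation φ) {v : Space d → ℝ}
    (hv : ContinuousOn v (closure (T.imageDomain φ)))
    (hv₀ : ∀ x ∈ frontier (T.imageDomain φ), v x = 0) {κ : ℝ≥0}
    (hLip : ∀ K ∈ T.cells, LipschitzOnWith κ v (imageCell φ K)) :
    LipschitzWith κ ((closure (T.imageDomain φ)).indicator v) := by
  have hcont : Continuous ((closure (T.imageDomain φ)).indicator v) :=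
    continuous_indicator (fun x hx => hv₀ x (frontier_closure_subset hx))
      (by rwa [closure_closure])
  rw [← lipschitzOnWith_univ]
  refine lipschitzOnWith_of_finite_closed_cover (ι := Option T.cells)
    (C := fun o => o.elim (interior (T.imageDomain φ))ᶜ fun K => imageCell φ K)
    convex_univ hcont.continuousOn ?_ (fun x _ => mem_iUnion.2 ?_) ?_
  · rintro (_ | K)
    exacts [isOpen_interior.isClosed_compl, (h.isCompact_imageCell K.2).isClosed]
  · by_cases hx : x ∈ interior (T.imageDomain φ)
    · have hmem := subset_closure (interior_subset hx)
      rw [h.closure_imageDomain, T.image_region] at hmem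
      exact (mem_iUnion.1 hmem).imp' some fun _ hK => hK
    · exact ⟨none, hx⟩
  · rintro (_ | K) x ⟨hx, -⟩ y ⟨hy, -⟩
    · rw [indicator_closure_eq_zero hv₀ hx, indicator_closure_eq_zero hv₀ hy, edist_self]
      exact zero_le
    · rw [indicator_of_mem (h.imageCell_subset_closure K.2 hx),
        indicator_of_mem (h.imageCell_subset_closure K.2 hy)]
      exact hLip K K.2 hx hy

end Triangulation.IsDeformation

namespace ALEMotion

variable {M : ALEMotion d N} {n : ℕ}

theorem interpInv_one (n : ℕ) : M.interpInv n 1 = M.ref.inverse (M.map (n + 1)) := by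
  rw [← M.interp_one]
  rfl

theorem exists_affine_velocity (hn : n < N) (Δt : ℝ) {K : Finset (Space d)}
    (hK : K ∈ M.ref.cells) :
    ∃ g : Space d →ᴬ[ℝ] Space d, EqOn (M.velocity Δt (n + 1)) g (imageCell (M.map (n + 1)) K) := by
  have h₁ := M.isDeformation_map hn (by omega)
  obtain ⟨e₀, he₀⟩ := (M.isDeformation_map hn.le (by omega)).exists_affineEquiv hK
  obtain ⟨e₁, he₁⟩ := h₁.exists_affineEquiv hK
  refine ⟨(Δt⁻¹ • (e₁.toContinuousAffineMap - e₀.toContinuousAffineMap)).comp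
    e₁.symm.toContinuousAffineMap, fun x hx => ?_⟩
  simp only [velocity, stepVelocity, interpInv_one]
  rw [he₀ (h₁.inverse_mem hK hx), he₁ (h₁.inverse_mem hK hx), h₁.inverse_eqOn hK he₁ hx]
  rfl

theorem continuousOn_velocity (hn : n < N) (Δt : ℝ) :
    ContinuousOn (M.velocity Δt (n + 1)) (closure (M.domain (n + 1))) :=
  (M.isDeformation_map hn (by omega)).continuousOn_closure fun K hK => by
    obtain ⟨g, hg⟩ := exists_affine_velocity hn Δt hK
    exact g.continuous.continuousOn.congr hg

theorem locallyLipschitzOn_velocity (hn : n < N) (Δt : ℝ) :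
    LocallyLipschitzOn (interior (M.domain (n + 1))) (M.velocity Δt (n + 1)) := by
  have h := M.isDeformation_map hn (by omega)
  obtain ⟨κ, hκ⟩ := h.exists_forall_lipschitzOnWith fun K hK =>
    (exists_affine_velocity hn Δt hK).imp' _ fun g hg => ⟨g.contDiff, hg⟩
  exact h.locallyLipschitzOn_interior (continuousOn_velocity hn Δt) hκ

end ALEMotion
end FiniteElement

namespace ALEMotion

variable {d N : ℕ} {M : ALEMotion d N} {k n : ℕ} {v : Space d → ℝ}

theorem exists_lipschitzWith_indicator (h : M.ref.IsDeformation (M.map n))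
    (hv : v ∈ M.feSpace k n) : ∃ κ, LipschitzWith κ ((closure (M.domain n)).indicator v) := by
  obtain ⟨κ, hκ⟩ := h.exists_forall_lipschitzOnWith fun K hK =>
    (hv.2.2 K hK).imp' _ fun p hp => ⟨contDiff_mvPolynomial_eval p, hp.2⟩
  exact ⟨κ, h.lipschitzWith_indicator hv.1 hv.2.1 hκ⟩

theorem indicator_eqOn_interior : EqOn ((closure (M.domain n)).indicator v) v
    (interior (M.domain n)) :=
  fun _ hx => indicator_of_mem (subset_closure (interior_subset hx)) v

theorem fderiv_indicator_eq {x : Space d} (hx : x ∈ interior (M.domain n)) :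
    fderiv ℝ ((closure (M.domain n)).indicator v) x = fderiv ℝ v x :=
  (indicator_eqOn_interior.eventuallyEq_of_mem (isOpen_interior.mem_nhds hx)).fderiv_eq

theorem memLp_gradient (h : M.ref.IsDeformation (M.map n)) (hv : v ∈ M.feSpace k n) :
    MemLp (gradient v) 2 (volume.restrict (M.domain n)) := by
  have : IsFiniteMeasure (volume.restrict (M.domain n)) := h.isFiniteMeasure_imageDomain
  obtain ⟨κ, hκ⟩ := exists_lipschitzWith_indicator h hv
  refine MemLp.of_bound (measurable_gradient v).aestronglyMeasurable κ ?_
  filter_upwards [h.ae_mem_interior_imageDomain] with x hx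
  rw [gradient, LinearIsometryEquiv.norm_map, ← fderiv_indicator_eq hx]
  exact norm_fderiv_le_of_lipschitz ℝ hκ

theorem memLp_laplacian (h : M.ref.IsDeformation (M.map n)) (hv : v ∈ M.feSpace k n) :
    MemLp (Laplacian.laplacian v) 2 (volume.restrict (M.domain n)) := by
  refine h.memLp_imageDomain fun K hK => ?_
  obtain ⟨q, -, hq⟩ := hv.2.2 K hK
  have hcont := continuous_laplacian (contDiff_mvPolynomial_eval q)
  have heq : Laplacian.laplacian (fun x : Space d => MvPolynomial.eval (fun i => x i) q)
      =ᵐ[volume.restrict (imageCell (M.map n) K)] Laplacian.laplacian v := by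
    filter_upwards [h.ae_mem_interior_imageCell hK] with x hx
    refine (InnerProductSpace.laplacian_congr_nhds ?_).eq_of_nhds
    exact EqOn.eventuallyEq_of_mem (fun y hy => (hq y hy).symm) (mem_interior_iff_mem_nhds.1 hx)
  exact (memLp_congr_ae heq).1
    (memLp_of_isCompact_of_continuousOn (h.isCompact_imageCell hK) hcont.continuousOn 2)

theorem integral_convection_reaction_ge (h : M.ref.IsDeformation (M.map n))
    (hv : v ∈ M.feSpace k n) {B : Space d → Space d}
    (hB : LocallyLipschitzOn (interior (M.domain n)) B) {C : ℝ}
    (hBC : ∀ x ∈ interior (M.domain n), ‖B x‖ ≤ C) {c : Space d → ℝ} {m : ℝ}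
    (hc : MemLp c ⊤ (volume.restrict (M.domain n)))
    (hm : ∀ᵐ x ∂(volume.restrict (M.domain n)), m ≤ c x - 1 / 2 * divergence B x) :
    m * M.normSq n v ≤ (∫ x in M.domain n, inner ℝ (B x) (gradient v x) * v x) +
      ∫ x in M.domain n, c x * v x * v x := by
  have : IsFiniteMeasure (volume.restrict (M.domain n)) := h.isFiniteMeasure_imageDomain
  have hv₂ : MemLp v 2 (volume.restrict (M.domain n)) := h.memLp_of_continuousOn hv.1 2
  have hconv : Integrable (fun x => inner ℝ (B x) (gradient v x) * v x)
      (volume.restrict (M.domain n)) :=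
    (memLp_inner (h.memLp_top_of_continuousOn_interior hB.continuousOn hBC)
      (memLp_gradient h hv)).integrable_mul hv₂
  have hreac : Integrable (fun x => c x * v x * v x) (volume.restrict (M.domain n)) :=
    (hv₂.mul' (r := 2) hc).integrable_mul hv₂
  have hres : volume.restrict (interior (M.domain n)) = volume.restrict (M.domain n) :=
    Measure.restrict_congr_set h.interior_imageDomain_ae_eq
  have hnonneg : 0 ≤ ∫ x in M.domain n,
      (inner ℝ (B x) (gradient v x) * v x + (c x - m) * v x ^ 2) := by
    obtain ⟨κ, hκ⟩ := exists_lipschitzWith_indicator h hv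
    refine (integral_convection_reaction_nonneg (c := fun x => c x - m) isOpen_interior hκ
      (HasCompactSupport.intro h.isCompact_closure_imageDomain
        fun x hx => indicator_of_notMem hx v)
      (fun x hx => indicator_closure_eq_zero hv.2.1 hx) hB hBC
      (hres ▸ hc.sub (memLp_const m))
      (hres ▸ hm.mono fun x hx => by linarith)).trans_eq ?_
    rw [← hres]
    refine setIntegral_congr_fun isOpen_interior.measurableSet fun x hx => ?_
    simp only [indicator_eqOn_interior hx, fderiv_indicator_eq hx, inner_gradient_right,
      conj_trivial]
  have hsplit : ∫ x in M.domain n,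
      (inner ℝ (B x) (gradient v x) * v x + (c x - m) * v x ^ 2) =
      (∫ x in M.domain n, inner ℝ (B x) (gradient v x) * v x) +
        (∫ x in M.domain n, c x * v x * v x) - m * M.normSq n v := by
    rw [normSq, ← integral_const_mul, ← integral_add hconv hreac,
      ← integral_sub (by exact hconv.add hreac) (hv₂.integrable_sq.const_mul m)]
    congr! 2 with x
    ring
  linarith

theorem divergence_neg (F : Space d → Space d) (x : Space d) :
    divergence (fun y => -F y) x = -divergence F x := by
  simp [divergence, fderiv_fun_neg]

theorem integral_velocity_mul_le (hn : n < N) (Δt : ℝ) (hv : v ∈ M.feSpace k (n + 1)) :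
    ∫ x in M.domain (n + 1), inner ℝ (M.velocity Δt (n + 1) x) (gradient v x) * v x ≤
      1 / 2 * M.alpha₁ Δt (n + 1) * M.normSq (n + 1) v := by
  have h : M.ref.IsDeformation (M.map (n + 1)) := M.isDeformation_map hn (by omega)
  obtain ⟨C, hC⟩ := h.isCompact_closure_imageDomain.exists_bound_of_continuousOn
    (continuousOn_velocity hn Δt)
  have hbound : ∀ᵐ x ∂(volume.restrict (M.domain (n + 1))), -(1 / 2 * M.alpha₁ Δt (n + 1)) ≤
      0 - 1 / 2 * divergence (fun y => -M.velocity Δt (n + 1) y) x := by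
    filter_upwards [abs_divergence_le_alpha₁ hn Δt] with x hx
    rw [divergence_neg]
    linarith [neg_le_of_abs_le hx]
  have hge := integral_convection_reaction_ge h hv
    (locallyLipschitzOn_neg_iff.2 (locallyLipschitzOn_velocity hn Δt))
    (fun x hx => (norm_neg _).trans_le (hC x (subset_closure (interior_subset hx))))
    MemLp.zero' hbound
  simp only [Pi.neg_apply, inner_neg_left, neg_mul, zero_mul, integral_zero, add_zero,
    integral_neg] at hge
  linarith

end ALEMotion

/-! ### Integral and discrete inequalities -/

section SquareIntegrable

variable {X : Type*} [MeasurableSpace X] {ν : Measure X}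

theorem integral_residual_mul_ge {L s q : X → ℝ} (hL : MemLp L 2 ν) (hs : MemLp s 2 ν)
    (hq : MemLp q 2 ν) :
    1 / 2 * (∫ x, s x ^ 2 ∂ν) - (∫ x, L x ^ 2 ∂ν) - ∫ x, q x ^ 2 ∂ν ≤
      ∫ x, (L x + s x + q x) * s x ∂ν := by
  have hsL := (hs.integrable_sq.const_mul (1 / 2)).sub hL.integrable_sq
  rw [← integral_const_mul, ← integral_sub (hs.integrable_sq.const_mul _) hL.integrable_sq,
    ← integral_sub (by exact hsL) hq.integrable_sq]
  refine integral_mono (hsL.sub hq.integrable_sq) (((hL.add hs).add hq).integrable_mul hs)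
    fun x => ?_
  linarith [sq_nonneg (s x / 2 + L x), sq_nonneg (s x / 2 + q x)]

theorem integral_mul_le_weighted {f g : X → ℝ} (hf : MemLp f 2 ν) (hg : MemLp g 2 ν) {η : ℝ}
    (hη : 0 < η) :
    ∫ x, f x * g x ∂ν ≤ 1 / η * (∫ x, f x ^ 2 ∂ν) + η / 4 * ∫ x, g x ^ 2 ∂ν := by
  rw [← integral_const_mul, ← integral_const_mul,
    ← integral_add (hf.integrable_sq.const_mul _) (hg.integrable_sq.const_mul _)]
  refine integral_mono (hf.integrable_mul hg)
    ((hf.integrable_sq.const_mul _).add (hg.integrable_sq.const_mul _)) fun x => ?_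
  have hsq : 1 / η * f x ^ 2 + η / 4 * g x ^ 2 - f x * g x = 1 / η * (f x - η / 2 * g x) ^ 2 := by
    field_simp
    ring
  exact sub_nonneg.1 (hsq.symm ▸ by positivity)

theorem integral_bdf2_mul_ge {a b c : X → ℝ} (ha : MemLp a 2 ν) (hb : MemLp b 2 ν)
    (hc : MemLp c 2 ν) :
    (∫ x, a x ^ 2 ∂ν) + (∫ x, (2 * a x - b x) ^ 2 ∂ν) - (∫ x, b x ^ 2 ∂ν) -
        ∫ x, (2 * b x - c x) ^ 2 ∂ν ≤
      4 * ∫ x, (3 / 2 * a x - 2 * b x + 1 / 2 * c x) * a x ∂ν := by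
  have hab : MemLp (fun x => 2 * a x - b x) 2 ν := (ha.const_mul 2).sub hb
  have hbc : MemLp (fun x => 2 * b x - c x) 2 ν := (hb.const_mul 2).sub hc
  have hdiff : MemLp (fun x => a x - 2 * b x + c x) 2 ν := (ha.sub (hb.const_mul 2)).add hc
  have hGstability : ∀ x, 4 * ((3 / 2 * a x - 2 * b x + 1 / 2 * c x) * a x) =
      a x ^ 2 + (2 * a x - b x) ^ 2 - b x ^ 2 - (2 * b x - c x) ^ 2 + (a x - 2 * b x + c x) ^ 2 :=
    fun x => by ring
  have hab' := ha.integrable_sq.add hab.integrable_sq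
  have hb' := hab'.sub hb.integrable_sq
  rw [← integral_const_mul, integral_congr_ae (.of_forall hGstability),
    integral_add (by exact hb'.sub hbc.integrable_sq) hdiff.integrable_sq,
    integral_sub (by exact hb') hbc.integrable_sq, integral_sub (by exact hab') hb.integrable_sq,
    integral_add ha.integrable_sq hab.integrable_sq]
  exact le_add_of_nonneg_right (integral_nonneg fun x => sq_nonneg _)

theorem integral_euler_mul_ge {a b : X → ℝ} (ha : MemLp a 2 ν) (hb : MemLp b 2 ν) :
    (∫ x, a x ^ 2 ∂ν) - (∫ x, b x ^ 2 ∂ν) ≤ 2 * ∫ x, (a x - b x) * a x ∂ν := by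
  rw [← integral_const_mul, ← integral_sub ha.integrable_sq hb.integrable_sq]
  refine integral_mono (ha.integrable_sq.sub hb.integrable_sq)
    (((ha.sub hb).integrable_mul ha).const_mul 2) fun x => ?_
  linarith [sq_nonneg (a x - b x)]

theorem integral_sq_le_add_extrapolation {a b : X → ℝ} (ha : MemLp a 2 ν) (hb : MemLp b 2 ν) :
    ∫ x, a x ^ 2 ∂ν ≤ 1 / 2 * (∫ x, b x ^ 2 ∂ν) + 1 / 2 * ∫ x, (2 * a x - b x) ^ 2 ∂ν := by
  have hab : MemLp (fun x => 2 * a x - b x) 2 ν := (ha.const_mul 2).sub hb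
  rw [← integral_const_mul, ← integral_const_mul,
    ← integral_add (hb.integrable_sq.const_mul _) (hab.integrable_sq.const_mul _)]
  refine integral_mono ha.integrable_sq
    ((hb.integrable_sq.const_mul _).add (hab.integrable_sq.const_mul _)) fun x => ?_
  linarith [sq_nonneg (a x - b x)]

theorem integral_mul_sq_le_eLpNorm_top {c u : X → ℝ} (hc : MemLp c ⊤ ν) (hu : MemLp u 2 ν) :
    ∫ x, (c x * u x) ^ 2 ∂ν ≤ (eLpNorm c ⊤ ν).toReal ^ 2 * ∫ x, u x ^ 2 ∂ν := by
  rw [← integral_const_mul]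
  refine integral_mono_of_nonneg (.of_forall fun x => sq_nonneg _)
    (hu.integrable_sq.const_mul _) ?_
  filter_upwards [ae_le_eLpNormEssSup (f := c) (μ := ν)] with x hx
  rw [← eLpNorm_exponent_top] at hx
  have hcx : |c x| ≤ (eLpNorm c ⊤ ν).toReal := by simpa using ENNReal.toReal_mono hc.2.ne hx
  rw [mul_pow, ← sq_abs (c x)]
  gcongr

end SquareIntegrable

theorem one_add_mul_add_le_mul_exp {a b E T R : ℝ} (ha : 0 ≤ a) (hb : 0 ≤ b) (hab : a + b < 1)
    (hE : 0 ≤ E) (hT : 0 ≤ T) (h : (1 - a) * E + T ≤ R) :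
    (1 + b) * E + T ≤ R * Real.exp ((a + b) / (1 - (a + b))) := by
  have hpos : 0 < 1 - (a + b) := sub_pos.2 hab
  have hR : 0 ≤ R := le_trans (add_nonneg (mul_nonneg (by linarith) hE) hT) h
  have hE' : (1 + b) * (1 - (a + b)) * E ≤ (1 - a) * E :=
    mul_le_mul_of_nonneg_right (by linarith [mul_nonneg ha hb, sq_nonneg b]) hE
  have hT' : (1 - (a + b)) * T ≤ T := mul_le_of_le_one_left hT (by linarith)
  calc (1 + b) * E + T ≤ R / (1 - (a + b)) := by rw [le_div_iff₀ hpos]; linarith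
    _ = R * ((a + b) / (1 - (a + b)) + 1) := by field_simp; ring
    _ ≤ R * Real.exp ((a + b) / (1 - (a + b))) :=
      mul_le_mul_of_nonneg_left (Real.add_one_le_exp _) hR

theorem discrete_gronwall {n : ℕ} {a b E T D : ℕ → ℝ} (ha : ∀ j, 0 ≤ a j) (hb : ∀ j, 0 ≤ b j)
    (hab : ∀ j < n, a j + b j < 1) (hE : ∀ j, 0 ≤ E j) (hT : ∀ j < n, 0 ≤ T j) (hD : Monotone D)
    (h₀ : (1 - a 0) * E 0 + T 0 ≤ D 0)
    (hstep : ∀ j, j + 1 < n → (1 - a (j + 1)) * E (j + 1) + T (j + 1) ≤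
      (1 + b j) * E j + T j + (D (j + 1) - D j)) :
    ∀ j < n, E j + T j ≤
      D j * Real.exp (∑ i ∈ Finset.range (j + 1), (a i + b i) / (1 - (a i + b i))) := by
  have hexp : ∀ j < n,
      1 ≤ Real.exp (∑ i ∈ Finset.range (j + 1), (a i + b i) / (1 - (a i + b i))) := fun j hj =>
    Real.one_le_exp <| Finset.sum_nonneg fun i hi =>
      div_nonneg (add_nonneg (ha i) (hb i))
        (sub_nonneg.2 (hab i (by have := Finset.mem_range.1 hi; omega)).le)
  have key : ∀ j < n, (1 + b j) * E j + T j ≤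
      D j * Real.exp (∑ i ∈ Finset.range (j + 1), (a i + b i) / (1 - (a i + b i))) := by
    intro j hj
    induction j with
    | zero =>
      simpa using one_add_mul_add_le_mul_exp (ha 0) (hb 0) (hab 0 hj) (hE 0) (hT 0 hj) h₀
    | succ j ih =>
      rw [Finset.sum_range_succ, Real.exp_add, ← mul_assoc]
      refine one_add_mul_add_le_mul_exp (ha _) (hb _) (hab _ hj) (hE _) (hT _ hj) ?_
      have hincr := le_mul_of_one_le_right (sub_nonneg.2 (hD j.le_succ)) (hexp j (by omega))
      linarith [hstep j hj, ih (by omega)]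
  intro j hj
  linarith [key j hj, mul_nonneg (hb j) (hE j)]

/-! ### Stability of the scheme -/

theorem diam_imageCell_pos {d : ℕ} (hd : 0 < d) {T : Triangulation d} {φ : Space d → Space d}
    (h : T.IsDeformation φ) {K : Finset (Space d)} (hK : K ∈ T.cells) :
    0 < Metric.diam (imageCell φ K) := by
  have : Nonempty (Fin d) := ⟨⟨0, hd⟩⟩
  obtain ⟨x, hx⟩ := h.interior_imageCell_nonempty hK
  refine Metric.diam_pos ?_ (h.isCompact_imageCell hK).isBounded
  have := Module.punctured_nhds_neBot ℝ (Space d) x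
  exact (infinite_of_mem_nhds x (mem_interior_iff_mem_nhds.1 hx)).nontrivial

namespace SchemeData

variable {d N : ℕ} {P : SchemeData d N} {μ cinv : ℝ} {m n : ℕ} {v : Space d → ℝ}
  {K : Finset (Space d)}

/-- The assumptions of the stability theorem on the coefficients, the source and the stabilization
parameters at the time level `t^n`. Upper bounds on `δ_K` are written without division, so that they
are void where the corresponding denominator vanishes. -/
structure IsAdmissible (P : SchemeData d N) (μ cinv : ℝ) (n : ℕ) : Prop where
  b_lipschitz : LocallyLipschitzOn (P.motion.domain n) (P.b (P.time n))
  b_bounded : ∃ C : ℝ, ∀ x ∈ P.motion.domain n, ‖P.b (P.time n) x‖ ≤ C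
  c_memLp : MemLp (P.c (P.time n)) ⊤ (volume.restrict (P.motion.domain n))
  f_memLp : MemLp (P.f (P.time n)) 2 (volume.restrict (P.motion.domain n))
  coercive : ∀ᵐ x ∂(volume.restrict (P.motion.domain n)),
    μ ≤ P.c (P.time n) x - 1 / 2 * divergence (P.b (P.time n)) x
  inverse_inequality : ∀ v ∈ P.motion.feSpace P.k n, ∀ K ∈ P.motion.ref.cells,
    Metric.diam (P.motion.cell n K) ^ 2 * ∫ x in P.motion.cell n K, Laplacian.laplacian v x ^ 2 ≤
      cinv ^ 2 * ∫ x in P.motion.cell n K, ‖gradient v x‖ ^ 2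
  δ_nonneg : ∀ K ∈ P.motion.ref.cells, 0 ≤ P.δ n K
  δ_le_reaction : ∀ K ∈ P.motion.ref.cells,
    2 * (eLpNorm (P.c (P.time n)) ⊤ (volume.restrict (P.motion.cell n K))).toReal ^ 2 *
      P.δ n K ≤ μ
  δ_le_diffusion : ∀ K ∈ P.motion.ref.cells,
    2 * P.ε * cinv ^ 2 * P.δ n K ≤ Metric.diam (P.motion.cell n K) ^ 2
  δ_le_timeStep : ∀ K ∈ P.motion.ref.cells, P.δ n K ≤ P.Δt / 4

namespace IsAdmissible

theorem tripleNormSq_nonneg (H : P.IsAdmissible μ cinv n) (hε : 0 ≤ P.ε) (hμ : 0 ≤ μ) :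
    0 ≤ P.tripleNormSq μ n v :=
  add_nonneg (add_nonneg (mul_nonneg hε (integral_nonneg fun _ => sq_nonneg _))
      (Finset.sum_nonneg fun K hK => mul_nonneg (H.δ_nonneg K hK)
        (integral_nonneg fun _ => sq_nonneg _)))
    (mul_nonneg hμ (ALEMotion.normSq_nonneg _ _))

theorem memLp_streamline (H : P.IsAdmissible μ cinv (m + 1)) (hm : m < N)
    (hv : v ∈ P.motion.feSpace P.k (m + 1)) :
    MemLp (P.streamline (m + 1) v) 2 (volume.restrict (P.motion.domain (m + 1))) := by
  have h : P.motion.ref.IsDeformation (P.motion.map (m + 1)) :=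
    P.motion.isDeformation_map hm (by omega)
  obtain ⟨C, hC⟩ := H.b_bounded
  have hb : MemLp (P.b (P.time (m + 1))) ⊤ (volume.restrict (P.motion.domain (m + 1))) :=
    h.memLp_top_of_continuousOn_interior (H.b_lipschitz.continuousOn.mono interior_subset)
      fun x hx => hC x (interior_subset hx)
  have hw : MemLp (P.motion.velocity P.Δt (m + 1)) ⊤
      (volume.restrict (P.motion.domain (m + 1))) :=
    ALEMotion.memLp_of_continuousOn hm (by omega) (ALEMotion.continuousOn_velocity hm P.Δt) ⊤
  exact memLp_inner (hb.sub hw) (ALEMotion.memLp_gradient h hv)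

theorem stabilized_reaction_le (H : P.IsAdmissible μ cinv n) (hK : K ∈ P.motion.ref.cells)
    (hc : MemLp (P.c (P.time n)) ⊤ (volume.restrict (P.motion.cell n K)))
    (hv : MemLp v 2 (volume.restrict (P.motion.cell n K))) :
    P.δ n K * ∫ x in P.motion.cell n K, (P.c (P.time n) x * v x) ^ 2 ≤
      μ / 2 * ∫ x in P.motion.cell n K, v x ^ 2 := by
  have hV : 0 ≤ ∫ x in P.motion.cell n K, v x ^ 2 := integral_nonneg fun _ => sq_nonneg _
  have hcv := mul_le_mul_of_nonneg_left (integral_mul_sq_le_eLpNorm_top hc hv) (H.δ_nonneg K hK)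
  linarith [mul_le_mul_of_nonneg_right (H.δ_le_reaction K hK) hV]

theorem stabilized_diffusion_le (H : P.IsAdmissible μ cinv n) (hε : 0 ≤ P.ε)
    (hv : v ∈ P.motion.feSpace P.k n) (hK : K ∈ P.motion.ref.cells)
    (hdiam : 0 < Metric.diam (P.motion.cell n K)) :
    P.δ n K * ∫ x in P.motion.cell n K, (-P.ε * Laplacian.laplacian v x) ^ 2 ≤
      P.ε / 2 * ∫ x in P.motion.cell n K, ‖gradient v x‖ ^ 2 := by
  have hΓ : 0 ≤ ∫ x in P.motion.cell n K, ‖gradient v x‖ ^ 2 :=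
    integral_nonneg fun _ => sq_nonneg _
  have hinv := mul_le_mul_of_nonneg_left (H.inverse_inequality v hv K hK)
    (mul_nonneg (H.δ_nonneg K hK) (sq_nonneg P.ε))
  have hδ := mul_le_mul_of_nonneg_right (H.δ_le_diffusion K hK)
    (mul_nonneg (div_nonneg hε zero_le_two) hΓ)
  simp only [mul_pow, neg_sq, integral_const_mul]
  refine le_of_mul_le_mul_left ?_ (pow_pos hdiam 2)
  linarith

theorem stabilization_ge (H : P.IsAdmissible μ cinv (m + 1)) (hd : 0 < d) (hε : 0 ≤ P.ε)
    (hm : m < N) (hv : v ∈ P.motion.feSpace P.k (m + 1)) (hK : K ∈ P.motion.ref.cells) :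
    1 / 2 * (P.δ (m + 1) K * ∫ x in P.motion.cell (m + 1) K, P.streamline (m + 1) v x ^ 2) -
        P.ε / 2 * (∫ x in P.motion.cell (m + 1) K, ‖gradient v x‖ ^ 2) -
        μ / 2 * (∫ x in P.motion.cell (m + 1) K, v x ^ 2) ≤
      P.δ (m + 1) K * ∫ x in P.motion.cell (m + 1) K,
        (-P.ε * Laplacian.laplacian v x + P.streamline (m + 1) v x +
          P.c (P.time (m + 1)) x * v x) * P.streamline (m + 1) v x := by
  have h : P.motion.ref.IsDeformation (P.motion.map (m + 1)) :=
    P.motion.isDeformation_map hm (by omega)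
  have hle := ALEMotion.restrict_cell_le hm (by omega) hK
  have hv₂ := (ALEMotion.memLp_of_continuousOn hm (by omega) hv.1 2).mono_measure hle
  have hc := H.c_memLp.mono_measure hle
  have hresidual := mul_le_mul_of_nonneg_left
    (integral_residual_mul_ge (((ALEMotion.memLp_laplacian h hv).mono_measure hle).const_mul (-P.ε))
      ((H.memLp_streamline hm hv).mono_measure hle) (hv₂.mul' (r := 2) hc)) (H.δ_nonneg K hK)
  linarith [H.stabilized_reaction_le hK hc hv₂,
    H.stabilized_diffusion_le hε hv hK (diam_imageCell_pos hd h hK)]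

theorem spatialForm_self_ge (H : P.IsAdmissible μ cinv (m + 1)) (hd : 0 < d) (hε : 0 ≤ P.ε)
    (hm : m < N) (hv : v ∈ P.motion.feSpace P.k (m + 1)) :
    1 / 2 * P.tripleNormSq μ (m + 1) v -
        1 / 2 * P.motion.alpha₁ P.Δt (m + 1) * P.motion.normSq (m + 1) v ≤
      P.spatialForm (m + 1) v v := by
  have hN : 0 < N := by omega
  have h : P.motion.ref.IsDeformation (P.motion.map (m + 1)) := P.motion.isDeformation_map hm hN
  obtain ⟨C, hC⟩ := H.b_bounded
  have hconv := ALEMotion.integral_convection_reaction_ge h hv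
    (H.b_lipschitz.mono interior_subset) (fun x hx => hC x (interior_subset hx)) H.c_memLp
    H.coercive
  have hmesh := ALEMotion.integral_velocity_mul_le hm P.Δt hv
  have hstab := Finset.sum_le_sum fun K hK => H.stabilization_ge hd hε hm hv (K := K) hK
  rw [Finset.sum_sub_distrib, Finset.sum_sub_distrib, ← Finset.mul_sum, ← Finset.mul_sum,
    ← Finset.mul_sum,
    ← ALEMotion.setIntegral_domain hm hN (ALEMotion.memLp_gradient h hv).norm.integrable_sq,
    ← ALEMotion.setIntegral_domain hm hN
      (ALEMotion.memLp_of_continuousOn hm hN hv.1 2).integrable_sq] at hstab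
  simp only [spatialForm, aSUPG, tripleNormSq, real_inner_self_eq_norm_sq, ALEMotion.normSq]
    at hconv hmesh ⊢
  linarith

theorem stabilized_load_le (H : P.IsAdmissible μ cinv (m + 1)) (hm : m < N)
    (hv : v ∈ P.motion.feSpace P.k (m + 1)) (hK : K ∈ P.motion.ref.cells) :
    P.δ (m + 1) K * ∫ x in P.motion.cell (m + 1) K,
        P.f (P.time (m + 1)) x * P.streamline (m + 1) v x ≤
      P.Δt / 4 * (∫ x in P.motion.cell (m + 1) K, P.f (P.time (m + 1)) x ^ 2) +
        1 / 4 * (P.δ (m + 1) K * ∫ x in P.motion.cell (m + 1) K,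
          P.streamline (m + 1) v x ^ 2) := by
  have hle := ALEMotion.restrict_cell_le hm (by omega) hK
  have hF : 0 ≤ ∫ x in P.motion.cell (m + 1) K, P.f (P.time (m + 1)) x ^ 2 :=
    integral_nonneg fun _ => sq_nonneg _
  have hyoung := mul_le_mul_of_nonneg_left
    (integral_mul_le_weighted (H.f_memLp.mono_measure hle)
      ((H.memLp_streamline hm hv).mono_measure hle) one_pos) (H.δ_nonneg K hK)
  linarith [mul_le_mul_of_nonneg_right (H.δ_le_timeStep K hK) hF]

theorem load_le (H : P.IsAdmissible μ cinv (m + 1)) (hε : 0 ≤ P.ε) (hμ : 0 < μ) (hm : m < N)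
    (hv : v ∈ P.motion.feSpace P.k (m + 1)) :
    P.load (m + 1) v ≤ (1 / μ + P.Δt / 4) * P.motion.normSq (m + 1) (P.f (P.time (m + 1))) +
      1 / 4 * P.tripleNormSq μ (m + 1) v := by
  have hN : 0 < N := by omega
  have hsource := integral_mul_le_weighted H.f_memLp
    (ALEMotion.memLp_of_continuousOn hm hN hv.1 2) hμ
  have hstab := Finset.sum_le_sum fun K hK => H.stabilized_load_le hm hv (K := K) hK
  rw [Finset.sum_add_distrib, ← Finset.mul_sum, ← Finset.mul_sum,
    ← ALEMotion.setIntegral_domain hm hN H.f_memLp.integrable_sq] at hstab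
  have hdiffusion : 0 ≤ P.ε * ∫ x in P.motion.domain (m + 1), ‖gradient v x‖ ^ 2 :=
    mul_nonneg hε (integral_nonneg fun _ => sq_nonneg _)
  simp only [load, tripleNormSq, ALEMotion.normSq]
  linarith

theorem load_sub_spatialForm_self_le (H : P.IsAdmissible μ cinv (m + 1)) (hd : 0 < d)
    (hε : 0 ≤ P.ε) (hμ : 0 < μ) (hm : m < N) (hv : v ∈ P.motion.feSpace P.k (m + 1)) :
    P.load (m + 1) v - P.spatialForm (m + 1) v v ≤
      1 / 2 * ((2 / μ + P.Δt / 2) * P.motion.normSq (m + 1) (P.f (P.time (m + 1)))) -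
        1 / 4 * P.tripleNormSq μ (m + 1) v +
        1 / 2 * P.motion.alpha₁ P.Δt (m + 1) * P.motion.normSq (m + 1) v := by
  rw [← mul_one_div 2 μ]
  linarith [H.spatialForm_self_ge hd hε hm hv, H.load_le hε hμ hm hv]

end IsAdmissible
end SchemeData

namespace ALEMotion

theorem ae_transfer_transfer {d N : ℕ} (M : ALEMotion d N) {m n : ℕ} (l : ℕ) (hm : m ≤ N)
    (hn : n ≤ N) (hN : 0 < N) :
    ∀ᵐ x ∂(volume.restrict (M.domain n)),
      M.transfer m l (M.transfer n m x) = M.transfer n l x := by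
  have h := M.isDeformation_map hn hN
  refine h.ae_imageDomain_iff.2 fun K hK => ?_
  filter_upwards [ae_restrict_mem (h.measurableSet_imageCell hK)] with x hx
  exact congrArg (M.map l) ((M.isDeformation_map hm hN).inverse_apply
    (Triangulation.simplex_subset_region hK (h.inverse_mem hK hx)))

end ALEMotion

namespace SchemeData

variable {d N : ℕ} {P : SchemeData d N} {μ cinv : ℝ} {u : ℕ → Space d → ℝ} {m : ℕ}

/-- The discrete energy `‖u^{n+1}‖² + ‖2u^{n+1} - u^n‖²` at time `t^{n+1}`, the quantity in which
BDF-2 is G-stable. -/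
def energy (P : SchemeData d N) (u : ℕ → Space d → ℝ) (n : ℕ) : ℝ :=
  P.motion.normSq (n + 1) (u (n + 1)) + P.extrapolationSq u n

theorem extrapolationSq_nonneg (P : SchemeData d N) (u : ℕ → Space d → ℝ) (n : ℕ) :
    0 ≤ P.extrapolationSq u n :=
  ALEMotion.normSq_nonneg _ _

theorem energy_nonneg (P : SchemeData d N) (u : ℕ → Space d → ℝ) (n : ℕ) : 0 ≤ P.energy u n :=
  add_nonneg (ALEMotion.normSq_nonneg _ _) (P.extrapolationSq_nonneg u n)

theorem IsEulerStep.integral_mul_eq (hE : P.IsEulerStep u m) (hΔt : P.Δt ≠ 0) {v : Space d → ℝ}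
    (hv : v ∈ P.motion.feSpace P.k (m + 1)) :
    ∫ x in P.motion.domain (m + 1),
        (u (m + 1) x - u m (P.motion.transfer (m + 1) m x)) * v x =
      P.Δt * (P.load (m + 1) v - P.spatialForm (m + 1) (u (m + 1)) v) := by
  simp only [← hE v hv, add_sub_cancel_right, div_mul_eq_mul_div, integral_div]
  rw [mul_div_cancel₀ _ hΔt]

theorem IsBDF2Step.integral_mul_eq (hB : P.IsBDF2Step u (m + 1)) (hΔt : P.Δt ≠ 0)
    {v : Space d → ℝ} (hv : v ∈ P.motion.feSpace P.k (m + 2)) :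
    ∫ x in P.motion.domain (m + 2),
        (3 / 2 * u (m + 2) x - 2 * u (m + 1) (P.motion.transfer (m + 2) (m + 1) x) +
          1 / 2 * u m (P.motion.transfer (m + 2) m x)) * v x =
      P.Δt * (P.load (m + 2) v - P.spatialForm (m + 2) (u (m + 2)) v) := by
  simp only [← hB v hv, add_sub_cancel_right, div_mul_eq_mul_div, integral_div,
    Nat.add_sub_cancel]
  rw [mul_div_cancel₀ _ hΔt]

theorem normSq_transfer_extrapolation_le (hm : m + 1 < N) (hΔt : 0 < P.Δt)
    (hu : ∀ n ≤ N, u n ∈ P.motion.feSpace P.k n) :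
    P.motion.normSq (m + 2) (fun x => 2 * u (m + 1) (P.motion.transfer (m + 2) (m + 1) x) -
        u m (P.motion.transfer (m + 2) m x)) ≤
      (1 + P.Δt * P.motion.alpha₂ P.Δt (m + 1)) * P.extrapolationSq u m := by
  have hN : 0 < N := by omega
  have hcont : ContinuousOn (fun x => 2 * u (m + 1) x - u m (P.motion.transfer (m + 1) m x))
      (closure (P.motion.domain (m + 1))) :=
    ((hu (m + 1) hm.le).1.const_mul 2).sub
      (ALEMotion.continuousOn_comp_transfer hm.le (by omega) hN (hu m (by omega)).1)
  refine le_trans (integral_congr_ae ?_).le (ALEMotion.normSq_transfer_le hm hΔt hcont)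
  filter_upwards [P.motion.ae_transfer_transfer (n := m + 2) m hm.le hm hN] with x hx
  rw [hx]

theorem IsBDF2Step.energy_le (hB : P.IsBDF2Step u (m + 1)) (hm : m + 1 < N) (hΔt : 0 < P.Δt)
    (hu : ∀ n ≤ N, u n ∈ P.motion.feSpace P.k n) :
    P.energy u (m + 1) ≤ (1 + P.Δt * P.motion.alpha₂ P.Δt (m + 1)) * P.energy u m +
      4 * (P.Δt * (P.load (m + 2) (u (m + 2)) -
        P.spatialForm (m + 2) (u (m + 2)) (u (m + 2)))) := by
  have hN : 0 < N := by omega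
  have hgstab : P.energy u (m + 1) -
      P.motion.normSq (m + 2) (fun x => u (m + 1) (P.motion.transfer (m + 2) (m + 1) x)) -
      P.motion.normSq (m + 2) (fun x => 2 * u (m + 1) (P.motion.transfer (m + 2) (m + 1) x) -
        u m (P.motion.transfer (m + 2) m x)) ≤
      4 * (P.Δt * (P.load (m + 2) (u (m + 2)) -
        P.spatialForm (m + 2) (u (m + 2)) (u (m + 2)))) := by
    rw [← hB.integral_mul_eq hΔt.ne' (hu (m + 2) hm)]
    exact integral_bdf2_mul_ge (ALEMotion.memLp_of_continuousOn hm hN (hu (m + 2) hm).1 2)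
      (ALEMotion.memLp_of_continuousOn hm hN
        (ALEMotion.continuousOn_comp_transfer hm hm.le hN (hu (m + 1) hm.le).1) 2)
      (ALEMotion.memLp_of_continuousOn hm hN
        (ALEMotion.continuousOn_comp_transfer hm (by omega) hN (hu m (by omega)).1) 2)
  have hold : P.motion.normSq (m + 2)
      (fun x => u (m + 1) (P.motion.transfer (m + 2) (m + 1) x)) ≤
      (1 + P.Δt * P.motion.alpha₂ P.Δt (m + 1)) * P.motion.normSq (m + 1) (u (m + 1)) :=
    ALEMotion.normSq_transfer_le hm hΔt (hu (m + 1) hm.le).1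
  have hsum : P.energy u m = P.motion.normSq (m + 1) (u (m + 1)) + P.extrapolationSq u m := rfl
  rw [hsum, mul_add]
  linarith [normSq_transfer_extrapolation_le hm hΔt hu]

theorem IsEulerStep.normSq_le (hE : P.IsEulerStep u m) (hm : m < N) (hΔt : 0 < P.Δt)
    (hu : ∀ n ≤ N, u n ∈ P.motion.feSpace P.k n) :
    P.motion.normSq (m + 1) (u (m + 1)) ≤
      (1 + P.Δt * P.motion.alpha₂ P.Δt m) * P.motion.normSq m (u m) +
        2 * (P.Δt * (P.load (m + 1) (u (m + 1)) -
          P.spatialForm (m + 1) (u (m + 1)) (u (m + 1)))) := by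
  have hN : 0 < N := by omega
  have htest := hu (m + 1) hm
  have hold := hu m hm.le
  refine (sub_le_iff_le_add'.1 ?_).trans
    (add_le_add_left (ALEMotion.normSq_transfer_le hm hΔt hold.1) _)
  rw [← hE.integral_mul_eq hΔt.ne' htest]
  exact integral_euler_mul_ge (ALEMotion.memLp_of_continuousOn hm hN htest.1 2)
    (ALEMotion.memLp_of_continuousOn hm hN
      (ALEMotion.continuousOn_comp_transfer hm hm.le hN hold.1) 2)

theorem normSq_one_le (hN : 0 < N) (hΔt : 0 < P.Δt)
    (hu : ∀ n ≤ N, u n ∈ P.motion.feSpace P.k n) :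
    P.motion.normSq 1 (u 1) ≤
      1 / 2 * (1 + P.Δt * P.motion.alpha₂ P.Δt 0) * P.motion.normSq 0 (u 0) +
        1 / 2 * P.extrapolationSq u 0 := by
  have hold := ALEMotion.normSq_transfer_le hN hΔt (hu 0 N.zero_le).1
  have hsplit : P.motion.normSq 1 (u 1) ≤
      1 / 2 * P.motion.normSq 1 (fun x => u 0 (P.motion.transfer 1 0 x)) +
        1 / 2 * P.extrapolationSq u 0 :=
    integral_sq_le_add_extrapolation (ALEMotion.memLp_of_continuousOn hN hN (hu 1 hN).1 2)
      (ALEMotion.memLp_of_continuousOn hN hN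
        (ALEMotion.continuousOn_comp_transfer hN N.zero_le hN (hu 0 N.zero_le).1) 2)
  linarith

theorem mul_alpha₁_nonneg (hΔt : 0 ≤ P.Δt) (n : ℕ) : 0 ≤ 2 * P.Δt * P.motion.alpha₁ P.Δt n :=
  mul_nonneg (mul_nonneg zero_le_two hΔt) (ALEMotion.alpha₁_nonneg _ _)

theorem IsAdmissible.energy_bdf2_step (H : P.IsAdmissible μ cinv (m + 2)) (hd : 0 < d)
    (hΔt : 0 < P.Δt) (hε : 0 ≤ P.ε) (hμ : 0 < μ) (hm : m + 1 < N)
    (hu : ∀ n ≤ N, u n ∈ P.motion.feSpace P.k n) (hB : P.IsBDF2Step u (m + 1)) :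
    (1 - 2 * P.Δt * P.motion.alpha₁ P.Δt (m + 2)) * P.energy u (m + 1) +
        P.Δt * P.tripleNormSq μ (m + 2) (u (m + 2)) ≤
      (1 + P.Δt * P.motion.alpha₂ P.Δt (m + 1)) * P.energy u m +
        2 * P.Δt * ((2 / μ + P.Δt / 2) * P.motion.normSq (m + 2) (P.f (P.time (m + 2)))) := by
  have htime := hB.energy_le hm hΔt hu
  have hspace := mul_le_mul_of_nonneg_left
    (load_sub_spatialForm_self_le (m := m + 1) H hd hε hμ hm (hu (m + 2) hm)) hΔt.le
  simp only [add_assoc, Nat.reduceAdd] at hspace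
  have hext := mul_nonneg (mul_alpha₁_nonneg hΔt.le (m + 2)) (P.extrapolationSq_nonneg u (m + 1))
  have hsum : P.energy u (m + 1) =
      P.motion.normSq (m + 2) (u (m + 2)) + P.extrapolationSq u (m + 1) := rfl
  rw [hsum] at htime ⊢
  linarith

theorem IsAdmissible.energy_euler_step (H : P.IsAdmissible μ cinv (m + 1)) (hd : 0 < d)
    (hΔt : 0 < P.Δt) (hε : 0 ≤ P.ε) (hμ : 0 < μ) (hm : m < N)
    (hu : ∀ n ≤ N, u n ∈ P.motion.feSpace P.k n) (hE : P.IsEulerStep u m) :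
    (1 - 2 * P.Δt * P.motion.alpha₁ P.Δt (m + 1)) * P.energy u m +
        P.Δt / 2 * P.tripleNormSq μ (m + 1) (u (m + 1)) ≤
      (1 + P.Δt * P.motion.alpha₂ P.Δt m) * P.motion.normSq m (u m) + P.extrapolationSq u m +
        2 * P.Δt * ((2 / μ + P.Δt / 2) * P.motion.normSq (m + 1) (P.f (P.time (m + 1)))) := by
  have htime := hE.normSq_le hm hΔt hu
  have hspace := mul_le_mul_of_nonneg_left
    (H.load_sub_spatialForm_self_le hd hε hμ hm (hu (m + 1) hm)) hΔt.le
  have hα := mul_alpha₁_nonneg hΔt.le (m + 1)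
  have hnew := mul_nonneg hα (ALEMotion.normSq_nonneg (M := P.motion) (m + 1) (u (m + 1)))
  have hext := mul_nonneg hα (P.extrapolationSq_nonneg u m)
  have hf : 0 ≤ P.Δt * ((2 / μ + P.Δt / 2) * P.motion.normSq (m + 1) (P.f (P.time (m + 1)))) :=
    mul_nonneg hΔt.le (mul_nonneg (by positivity) (ALEMotion.normSq_nonneg _ _))
  rw [energy]
  linarith

theorem energy_zero_le (hN : 0 < N) (hΔt : 0 < P.Δt)
    (hu : ∀ n ≤ N, u n ∈ P.motion.feSpace P.k n) :
    (1 - 2 * P.Δt * P.motion.alpha₁ P.Δt 1) * P.energy u 0 ≤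
      1 / 2 * (1 + P.Δt * P.motion.alpha₂ P.Δt 0) * P.motion.normSq 0 (u 0) +
        3 / 2 * P.extrapolationSq u 0 := by
  calc (1 - 2 * P.Δt * P.motion.alpha₁ P.Δt 1) * P.energy u 0
      ≤ P.energy u 0 :=
        mul_le_of_le_one_left (P.energy_nonneg u 0) (sub_le_self _ (mul_alpha₁_nonneg hΔt.le 1))
    _ ≤ _ := by rw [energy]; linarith [normSq_one_le hN hΔt hu]

theorem growthFactor_eq_exp_sum_range (P : SchemeData d N) (n : ℕ) :
    P.growthFactor n = Real.exp (∑ i ∈ Finset.range n,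
      P.Δt * P.growth (i + 1) / (1 - P.Δt * P.growth (i + 1))) := by
  rw [growthFactor, Finset.mul_sum, Finset.range_eq_Ico,
    Finset.sum_Ico_add' (fun i => P.Δt * P.growth i / (1 - P.Δt * P.growth i)), zero_add,
    Finset.Ico_add_one_right_eq_Icc]
  simp only [mul_div_assoc]

theorem energy_add_sum_le (hd : 0 < d) (hΔt : 0 < P.Δt) (hε : 0 ≤ P.ε) (hμ : 0 < μ)
    (H : ∀ n, 1 ≤ n → n ≤ N → P.IsAdmissible μ cinv n)
    (hstep : ∀ n, 1 ≤ n → n ≤ N → P.Δt * P.growth n < 1)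
    (hu : ∀ n ≤ N, u n ∈ P.motion.feSpace P.k n)
    (hBDF : ∀ n, 1 ≤ n → n < N → P.IsBDF2Step u n) {T₀ D₀ : ℝ} (hT₀ : 0 ≤ T₀)
    (h₀ : (1 - 2 * P.Δt * P.motion.alpha₁ P.Δt 1) * P.energy u 0 + T₀ ≤ D₀) :
    ∀ n < N, P.energy u n +
        (T₀ + P.Δt * ∑ i ∈ Finset.Icc 2 (n + 1), P.tripleNormSq μ i (u i)) ≤
      (D₀ + 2 * P.Δt * ∑ i ∈ Finset.Icc 2 (n + 1),
        (2 / μ + P.Δt / 2) * P.motion.normSq i (P.f (P.time i))) * P.growthFactor (n + 1) := by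
  have hgrowth : ∀ n, P.Δt * P.growth n =
      2 * P.Δt * P.motion.alpha₁ P.Δt n + P.Δt * P.motion.alpha₂ P.Δt n := fun n => by
    rw [growth]; ring
  have hsum : ∀ (F : ℕ → ℝ) (j : ℕ), ∑ i ∈ Finset.Icc 2 (j + 1 + 1), F i =
      ∑ i ∈ Finset.Icc 2 (j + 1), F i + F (j + 2) := fun F j =>
    Finset.sum_Icc_succ_top (by omega) F
  simp only [growthFactor_eq_exp_sum_range, hgrowth]
  refine discrete_gronwall (fun j => mul_alpha₁_nonneg hΔt.le (j + 1))
    (fun j => mul_nonneg hΔt.le (ALEMotion.alpha₂_nonneg _ (j + 1)))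
    (fun j hj => hgrowth _ ▸ hstep (j + 1) (by omega) hj) (P.energy_nonneg u) ?_ ?_ ?_ ?_
  · refine fun j hj => add_nonneg hT₀ (mul_nonneg hΔt.le (Finset.sum_nonneg fun i hi => ?_))
    rw [Finset.mem_Icc] at hi
    exact (H i (by omega) (by omega)).tripleNormSq_nonneg hε hμ.le
  · refine monotone_nat_of_le_succ fun j => ?_
    rw [hsum, mul_add, ← add_assoc]
    exact le_add_of_nonneg_right (mul_nonneg (by positivity)
      (mul_nonneg (by positivity) (ALEMotion.normSq_nonneg _ _)))
  · simpa using h₀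
  · intro j hj
    have := (H (j + 2) (by omega) hj).energy_bdf2_step hd hΔt hε hμ hj hu
      (hBDF (j + 1) (by omega) hj)
    rw [hsum, hsum]
    linarith

end SchemeData

end ALESUPG

end

open ALESUPG in
theorem mainTheorem3_general {d N : ℕ} (hd : 0 < d) (P : SchemeData d N) (μ cinv : ℝ)
    (hΔt : 0 < P.Δt) (hε : 0 ≤ P.ε) (hμ : 0 < μ)
    (H : ∀ n, 1 ≤ n → n ≤ N → P.IsAdmissible μ cinv n)
    (hstep : ∀ n, 1 ≤ n → n ≤ N → P.Δt * P.growth n < 1)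
    (u : ℕ → Space d → ℝ)
    (hu : ∀ n ≤ N, u n ∈ P.motion.feSpace P.k n)
    (hBDF : ∀ n, 1 ≤ n → n < N → P.IsBDF2Step u n) :
    (∀ n < N,
      P.motion.normSq (n + 1) (u (n + 1)) + P.extrapolationSq u n +
          P.Δt * ∑ i ∈ Finset.Icc 2 (n + 1), P.tripleNormSq μ i (u i) ≤
        (1 / 2 * (1 + P.Δt * P.motion.alpha₂ P.Δt 0) * P.motion.normSq 0 (u 0) +
          3 / 2 * P.extrapolationSq u 0 +
          2 * P.Δt * ∑ i ∈ Finset.Icc 2 (n + 1),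
            (2 / μ + P.Δt / 2) * P.motion.normSq i (P.f (P.time i))) *
          P.growthFactor (n + 1)) ∧
    (P.IsEulerStep u 0 → ∀ n < N,
      P.motion.normSq (n + 1) (u (n + 1)) + P.extrapolationSq u n +
          P.Δt / 2 * P.tripleNormSq μ 1 (u 1) +
          P.Δt * ∑ i ∈ Finset.Icc 2 (n + 1), P.tripleNormSq μ i (u i) ≤
        ((1 + P.Δt * P.motion.alpha₂ P.Δt 0) * P.motion.normSq 0 (u 0) +
          P.extrapolationSq u 0 +
          2 * P.Δt * ∑ i ∈ Finset.Icc 1 (n + 1),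
            (2 / μ + P.Δt / 2) * P.motion.normSq i (P.f (P.time i))) *
          P.growthFactor (n + 1)) := by
  refine ⟨fun n hn => ?_, fun hEuler n hn => ?_⟩
  · have h₀ := SchemeData.energy_zero_le (by omega) hΔt hu
    simpa only [zero_add, SchemeData.energy] using
      SchemeData.energy_add_sum_le hd hΔt hε hμ H hstep hu hBDF le_rfl
        ((add_zero _).trans_le h₀) n hn
  · have hAdm : P.IsAdmissible μ cinv 1 := H 1 le_rfl (by omega)
    have hT₀ : 0 ≤ P.Δt / 2 * P.tripleNormSq μ 1 (u 1) :=
      mul_nonneg (half_pos hΔt).le (hAdm.tripleNormSq_nonneg hε hμ.le)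
    have h₀ := hAdm.energy_euler_step (m := 0) hd hΔt hε hμ (by omega) hu hEuler
    have hbound := SchemeData.energy_add_sum_le hd hΔt hε hμ H hstep hu hBDF hT₀ h₀ n hn
    rw [← Finset.insert_Icc_add_one_left_eq_Icc (Nat.le_add_left 1 n), Finset.sum_insert (by simp),
      mul_add, ← add_assoc]
    rwa [← add_assoc] at hbound

open ALESUPG in
theorem mainTheorem3 {d N : ℕ} (hd : d = 2 ∨ d = 3) (P : SchemeData d N) (μ cinv : ℝ)
    (hΔt : 0 < P.Δt) (hε : 0 < P.ε) (hμ : 0 < μ)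
    -- regularity of the coefficients and of the source at the time levels
    (hbLip : ∀ n, 1 ≤ n → n ≤ N → LocallyLipschitzOn (P.motion.domain n) (P.b (P.time n)))
    (hbBdd : ∀ n, 1 ≤ n → n ≤ N →
      ∃ C : ℝ, ∀ x ∈ P.motion.domain n, ‖P.b (P.time n) x‖ ≤ C)
    (hc : ∀ n, 1 ≤ n → n ≤ N →
      MemLp (P.c (P.time n)) ⊤ (volume.restrict (P.motion.domain n)))
    (hf : ∀ n, 1 ≤ n → n ≤ N →
      MemLp (P.f (P.time n)) 2 (volume.restrict (P.motion.domain n)))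
    -- discrete version of `c - (1/2) ∇·b ≥ μ`
    (hcoer : ∀ n, 1 ≤ n → n ≤ N → ∀ᵐ x ∂(volume.restrict (P.motion.domain n)),
      μ ≤ P.c (P.time n) x - 1 / 2 * divergence (P.b (P.time n)) x)
    -- conditions on the stabilization parameters
    (hcinv : P.motion.IsInverseConstant P.k cinv)
    (hδ0 : ∀ n, 1 ≤ n → n ≤ N → ∀ K ∈ P.motion.ref.cells, 0 ≤ P.δ n K)
    (hδc : ∀ n, 1 ≤ n → n ≤ N → ∀ K ∈ P.motion.ref.cells,
      2 * (eLpNorm (P.c (P.time n)) ⊤ (volume.restrict (P.motion.cell n K))).toReal ^ 2 *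
        P.δ n K ≤ μ)
    (hδh : ∀ n, 1 ≤ n → n ≤ N → ∀ K ∈ P.motion.ref.cells,
      2 * P.ε * cinv ^ 2 * P.δ n K ≤ Metric.diam (P.motion.cell n K) ^ 2)
    (hδt : ∀ n, 1 ≤ n → n ≤ N → ∀ K ∈ P.motion.ref.cells, P.δ n K ≤ P.Δt / 4)
    -- time step restriction
    (hstep : ∀ n ≤ N, P.Δt * P.growth n < 1)
    -- the BDF-2 solution
    (u : ℕ → Space d → ℝ)
    (hu : ∀ n ≤ N, u n ∈ P.motion.feSpace P.k n)
    (hBDF : ∀ n, 1 ≤ n → n < N → P.IsBDF2Step u n) :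
    -- arbitrary starting values
    (∀ n < N,
      P.motion.normSq (n + 1) (u (n + 1)) + P.extrapolationSq u n +
          P.Δt * ∑ i ∈ Finset.Icc 2 (n + 1), P.tripleNormSq μ i (u i) ≤
        (1 / 2 * (1 + P.Δt * P.motion.alpha₂ P.Δt 0) * P.motion.normSq 0 (u 0) +
          3 / 2 * P.extrapolationSq u 0 +
          2 * P.Δt * ∑ i ∈ Finset.Icc 2 (n + 1),
            (2 / μ + P.Δt / 2) * P.motion.normSq i (P.f (P.time i))) *
          P.growthFactor (n + 1)) ∧
    -- the first step made with the implicit Euler scheme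
    (P.IsEulerStep u 0 → ∀ n < N,
      P.motion.normSq (n + 1) (u (n + 1)) + P.extrapolationSq u n +
          P.Δt / 2 * P.tripleNormSq μ 1 (u 1) +
          P.Δt * ∑ i ∈ Finset.Icc 2 (n + 1), P.tripleNormSq μ i (u i) ≤
        ((1 + P.Δt * P.motion.alpha₂ P.Δt 0) * P.motion.normSq 0 (u 0) +
          P.extrapolationSq u 0 +
          2 * P.Δt * ∑ i ∈ Finset.Icc 1 (n + 1),
            (2 / μ + P.Δt / 2) * P.motion.normSq i (P.f (P.time i))) *
          P.growthFactor (n + 1)) :=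
  mainTheorem3_general (by omega) P μ cinv hΔt hε.le hμ
    (fun n h₁ hn => ⟨hbLip n h₁ hn, hbBdd n h₁ hn, hc n h₁ hn, hf n h₁ hn, hcoer n h₁ hn,
      hcinv n h₁ hn, hδ0 n h₁ hn, hδc n h₁ hn, hδh n h₁ hn, hδt n h₁ hn⟩)
    (fun n _ hn => hstep n hn) u hu hBDF
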